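/- Notation. For a complex matrix $A$, $A^H$ is its conjugate transpose. Let $\mathcal J=\begin{bmatrix}0&I_n\\-I_n&0\end{bmatrix}$. A matrix $\mathscr H\in\mathbb C^{2n\times2n}$ is Hamiltonian if $\mathscr H\mathcal J=(\mathscr H\mathcal J)^H$, and $\mathcal S\in\mathbb C^{2n\times2n}$ is symplectic if $\mathcal S\mathcal J\mathcal S^H=\mathcal J$. $N_k(\lambda)$ is the $k\times k$ upper triangular Jordan block with eigenvalue $\lambda$, and $e_k$ is the $k$-th (last) unit vector of $\mathbb C^k$. The elementary Hamiltonian Jordan blocks are $\mathfrak J_x=\begin{bmatrix}R_x&D_x\\G_x&-R_x^H\end{bmatrix}\in\mathbb C^{2n\times 2n}$, $x=r,e,c,d$, where - $x=r$: $R_r=N_n(\lambda)$ with $\Re\lambda>0$, $D_r=G_r=0$; - $x=e$: $R_e=N_n(i\alpha)$, $D_e=\beta e_ne_n^H$, $G_e=0$, with $\alpha\in\mathbb R$, $\beta\in\{-1,1\}$; - $x=c$: $n=n_1+n_2+1$, $\eta\in\mathbb R$, $\beta\in\{-1,1\}$, $G_c=0$ and $$R_c=\begin{bmatrix}N_{n_1}(i\eta)&0&-\tfrac{\sqrt2}2e_{n_1}\\0&N_{n_2}(i\eta)&-\tfrac{\sqrt2}2e_{n_2}\\0&0&i\eta\end{bmatrix},\quad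 D_c=\tfrac{\sqrt2}2i\beta\begin{bmatrix}0&0&e_{n_1}\\0&0&-e_{n_2}\\-e_{n_1}^H&e_{n_2}^H&0\end{bmatrix};$$ - $x=d$: $n=n_1+n_2+1$, $\gamma,\delta\in\mathbb R$, $\gamma\ne\delta$, $\beta\in\{-1,1\}$ and $$R_d=\begin{bmatrix}N_{n_1}(i\gamma)&0&-\tfrac{\sqrt2}2e_{n_1}\\0&N_{n_2}(i\delta)&-\tfrac{\sqrt2}2e_{n_2}\\0&0&\tfrac i2(\gamma+\delta)\end{bmatrix},\quad D_d=\tfrac{\sqrt2}2i\beta\begin{bmatrix}0&0&e_{n_1}\\0&0&-e_{n_2}\\-e_{n_1}^H&e_{n_2}^H&-i\tfrac{\sqrt2}2(\gamma-\delta)\end{bmatrix},\quad G_d=\beta\begin{bmatrix}0&0&0\\0&0&0\\0&0&-\tfrac12(\gamma-\delta)\end{bmatrix}.$$ (In cases $c$ and $d$, $n_1,n_2\ge0$, and the rows and columns belonging to $n_j=0$ are absent.) Setting. Let $\mathscr H\in\mathbb C^{2n\times2n}$ be Hamiltonian with $\mathcal S^{-1}\mathscr H\mathcal S=\mathfrak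 J_x$ for one of these blocks and some symplectic $\mathcal S$. Let $W_0\in\mathbb C^{n\times n}$ be Hermitian, let $Y(t)=\begin{bmatrix}Q(t)\\P(t)\end{bmatrix}$, $t\in\mathbb R$, with $Q(t),P(t)\in\mathbb C^{n\times n}$, be the solution of $\dot Y=\mathscr HY$, $Y(0)=\begin{bmatrix}I\\W_0\end{bmatrix}$, let $\mathcal T_W=\{t\in\mathbb R: Q(t)\text{ is invertible}\}$, and let $W(t)=P(t)Q(t)^{-1}$ for $t\in\mathcal T_W$ be the extended solution of the Riccati differential equation $\dot W=[-W,I]\mathscr H\begin{bmatrix}I\\W\end{bmatrix}$, $W(0)=W_0$. Put $\begin{bmatrix}W_1\\W_2\end{bmatrix}=\mathcal S^{-1}\begin{bmatrix}I\\W_0\end{bmatrix}$ with $W_1,W_2\in\mathbb C^{n\times n}$. Theorem 4.9. (i) Partition $\mathcal S=\begin{bmatrix}U_1&V_1\\U_2&V_2\end{bmatrix}$ into $n\times n$ blocks. 1. Let $x=r$. If $U_1$ and $W_1$ are invertible, then $Q(t)$ is invertible for all sufficiently large $t$ and, as $t\to\infty$, $$W(t)=U_2U_1^{-1}+O(e^{-2\Re(\lambda)t}t^{2(n-1)}),\qquad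 Q(t)^{-1}=O(e^{-\Re(\lambda)t}t^{n-1}).$$ If $V_1$ and $W_2$ are invertible, then $Q(t)$ is invertible for all sufficiently negative $t$ and, as $t\to-\infty$, $$W(t)=V_2V_1^{-1}+O(e^{-2\Re(\lambda)|t|}|t|^{2(n-1)}),\qquad Q(t)^{-1}=O(e^{-\Re(\lambda)|t|}|t|^{n-1}).$$ 2. Let $x=e$. If $U_1$ and $W_2$ are invertible, then $Q(t)$ is invertible for all sufficiently large $|t|$ and $W(t)=U_2U_1^{-1}+O(t^{-1})$, $Q(t)^{-1}=O(t^{-1})$ as $t\to\pm\infty$. (ii) In cases $c$ and $d$ partition further $\mathcal S=\begin{bmatrix}U_1&u_1&V_1&v_1\\U_2&u_2&V_2&v_2\end{bmatrix}$ with $U_j,V_j\in\mathbb C^{n\times(n_1+n_2)}$ and $u_j,v_j\in\mathbb C^n$. Suppose that $W_2$ is invertible, let $w$ be the lower right entry of $W_1W_2^{-1}$, and let $$f_u=\tfrac12(-1)^{n_1}(w-i\beta),\quad f_v=\tfrac12(-1)^{n_1}(i\beta w+1),\quad g_u=\tfrac12(-1)^{n_2}(w+i\beta),\quad g_v=\tfrac12(-1)^{n_2}(-i\beta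 w+1).$$ 3. Let $x=c$, $\tilde f_u=f_u+g_u$, $\tilde f_v=f_v+g_v$, and $\mathbf U_{j,0}=[U_j,\ \tilde f_uu_j+\tilde f_vv_j]\in\mathbb C^{n\times n}$ for $j=1,2$. If $\mathbf U_{1,0}$ is invertible, then $K_Q=W_2^{-1}e_ne_n^H\mathbf U_{1,0}^{-1}$ has rank one, $Q(t)$ is invertible for all sufficiently large $|t|$, and, as $t\to\pm\infty$, $$W(t)=\mathbf U_{2,0}\mathbf U_{1,0}^{-1}+O(t^{-1}),\qquad Q(t)^{-1}=e^{-i\eta t}K_Q+O(t^{-1}).$$ 4. Let $x=d$, $\theta=\delta-\gamma$, $\mathbf U_j=[U_j,\ f_uu_j+f_vv_j]\in\mathbb C^{n\times n}$ and $\zeta_j=g_uu_j+g_vv_j\in\mathbb C^n$ for $j=1,2$. If $\mathbf U_1$ is invertible, put $$c=e_n^H\mathbf U_1^{-1}\zeta_1,\qquad K_W=(\zeta_2-\mathbf U_2\mathbf U_1^{-1}\zeta_1)e_n^H\mathbf U_1^{-1},\qquad K_Q=W_2^{-1}e_ne_n^H\mathbf U_1^{-1}.$$ Then $|c|=1$,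 $K_W$ and $K_Q$ have rank one, and there are a scalar function $\varepsilon(t)$ and $n\times n$ matrix functions $E_1(t),\dots,E_4(t)$, all $O(t^{-1})$ as $t\to\pm\infty$, such that for all sufficiently large $|t|$: $Q(t)$ is invertible if and only if $1+e^{i\theta t}c+\varepsilon(t)\neq0$, and in that case $$W(t)=\mathbf U_2\mathbf U_1^{-1}+\frac{e^{i\theta t}}{1+e^{i\theta t}c+\varepsilon(t)}\,[K_W+E_1(t)]+E_2(t),$$ $$Q(t)^{-1}=\frac{e^{-i\gamma t}}{1+e^{i\theta t}c+\varepsilon(t)}\,[K_Q+E_3(t)]+E_4(t).$$ -/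

import Mathlib

open Filter Matrix Asymptotics

noncomputable section

namespace HamRiccati

/-! Matrices of size `2n × 2n` are indexed by `ι ⊕ ι` with `ι` a finite type of size `n`, so that
the four `n × n` blocks are those of `Matrix.fromBlocks`. -/

/-- `𝒥 = [[0, I], [-I, 0]]`. -/
def symJ (ι : Type) [DecidableEq ι] : Matrix (ι ⊕ ι) (ι ⊕ ι) ℂ :=
  fromBlocks 0 1 (-1) 0

/-- `H` is Hamiltonian: `H 𝒥 = (H 𝒥)ᴴ`. -/
def IsHamiltonian {ι : Type} [Fintype ι] [DecidableEq ι]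
    (H : Matrix (ι ⊕ ι) (ι ⊕ ι) ℂ) : Prop :=
  H * symJ ι = (H * symJ ι)ᴴ

/-- `S` is (conjugate) symplectic: `S 𝒥 Sᴴ = 𝒥`. -/
def IsSymplectic {ι : Type} [Fintype ι] [DecidableEq ι]
    (S : Matrix (ι ⊕ ι) (ι ⊕ ι) ℂ) : Prop :=
  S * symJ ι * Sᴴ = symJ ι

/-! ### The four elementary Hamiltonian Jordan blocks -/

/-- The `k × k` upper triangular Jordan block with eigenvalue `z`. -/
def jordanN (k : ℕ) (z : ℂ) : Matrix (Fin k) (Fin k) ℂ :=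
  of fun i j => if i = j then z else if (i : ℕ) + 1 = (j : ℕ) then 1 else 0

/-- The last standard unit vector `e_k` of `ℂᵏ`, as a column. -/
def lastE (k : ℕ) : Matrix (Fin k) Unit ℂ :=
  of fun i _ => if (i : ℕ) + 1 = k then 1 else 0

/-- The Hamiltonian matrix `[[R, D], [G, -Rᴴ]]`. -/
def hamBlocks {ι : Type} (R D G : Matrix ι ι ℂ) : Matrix (ι ⊕ ι) (ι ⊕ ι) ℂ :=
  fromBlocks R D G (-Rᴴ)

/-- Type `r`: `R = N_n(lam)`, `D = G = 0`. -/
def blockR (n : ℕ) (lam : ℂ) : Matrix (Fin n ⊕ Fin n) (Fin n ⊕ Fin n) ℂ :=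
  hamBlocks (jordanN n lam) 0 0

/-- Type `e`: `R = N_n(i α)`, `D = β e_n e_nᴴ`, `G = 0`. -/
def blockE (n : ℕ) (α : ℝ) (β : ℂ) : Matrix (Fin n ⊕ Fin n) (Fin n ⊕ Fin n) ℂ :=
  hamBlocks (jordanN n (Complex.I * α)) (β • (lastE n * (lastE n)ᴴ)) 0

/-- Index type of size `n₁ + n₂ + 1`; the last index is `Sum.inr ()`. -/
abbrev Idx (n₁ n₂ : ℕ) : Type := (Fin n₁ ⊕ Fin n₂) ⊕ Unit

/-- The real number `√2 / 2`, as a complex number. -/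
def halfSqrtTwo : ℂ := ((Real.sqrt 2 / 2 : ℝ) : ℂ)

/-- Type `c`:
`R = [[N_{n₁}(iη), 0, -√2/2 e_{n₁}], [0, N_{n₂}(iη), -√2/2 e_{n₂}], [0, 0, iη]]`,
`D = √2/2 i β [[0, 0, e_{n₁}], [0, 0, -e_{n₂}], [-e_{n₁}ᴴ, e_{n₂}ᴴ, 0]]`, `G = 0`. -/
def blockC (n₁ n₂ : ℕ) (η : ℝ) (β : ℂ) :
    Matrix (Idx n₁ n₂ ⊕ Idx n₁ n₂) (Idx n₁ n₂ ⊕ Idx n₁ n₂) ℂ :=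
  hamBlocks
    (fromBlocks
      (fromBlocks (jordanN n₁ (Complex.I * η)) 0 0 (jordanN n₂ (Complex.I * η)))
      (-halfSqrtTwo • fromRows (lastE n₁) (lastE n₂))
      0
      (of fun _ _ => Complex.I * η))
    ((halfSqrtTwo * Complex.I * β) • fromBlocks
      0
      (fromRows (lastE n₁) (-lastE n₂))
      (fromCols (-(lastE n₁)ᴴ) (lastE n₂)ᴴ)
      0)
    0

/-- Type `d`:
`R = [[N_{n₁}(iγ), 0, -√2/2 e_{n₁}], [0, N_{n₂}(iδ), -√2/2 e_{n₂}], [0, 0, (i/2)(γ+δ)]]`,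
`D = √2/2 i β [[0, 0, e_{n₁}], [0, 0, -e_{n₂}], [-e_{n₁}ᴴ, e_{n₂}ᴴ, -i √2/2 (γ-δ)]]`,
`G = β [[0, 0, 0], [0, 0, 0], [0, 0, -(1/2)(γ-δ)]]`. -/
def blockD (n₁ n₂ : ℕ) (γ δ : ℝ) (β : ℂ) :
    Matrix (Idx n₁ n₂ ⊕ Idx n₁ n₂) (Idx n₁ n₂ ⊕ Idx n₁ n₂) ℂ :=
  hamBlocks
    (fromBlocks
      (fromBlocks (jordanN n₁ (Complex.I * γ)) 0 0 (jordanN n₂ (Complex.I * δ)))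
      (-halfSqrtTwo • fromRows (lastE n₁) (lastE n₂))
      0
      (of fun _ _ => Complex.I / 2 * ((γ : ℂ) + δ)))
    ((halfSqrtTwo * Complex.I * β) • fromBlocks
      0
      (fromRows (lastE n₁) (-lastE n₂))
      (fromCols (-(lastE n₁)ᴴ) (lastE n₂)ᴴ)
      (of fun _ _ => -Complex.I * halfSqrtTwo * ((γ : ℂ) - δ)))
    (β • fromBlocks 0 0 0 (of fun _ _ => -(1 / 2) * ((γ : ℂ) - δ)))

/-! ### The linear flow and the extended solution of the Riccati equation -/

/-- The standing situation: `H` is Hamiltonian, `S` is a symplectic matrix that brings `H` to the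
canonical form `J`, `W₀` is Hermitian, and `Y` is the solution on `ℝ` of
`Y' = H Y`, `Y(0) = [I; W₀]`. -/
structure IsFlow {ι : Type} [Fintype ι] [DecidableEq ι]
    (J H S : Matrix (ι ⊕ ι) (ι ⊕ ι) ℂ) (W₀ : Matrix ι ι ℂ)
    (Y : ℝ → Matrix (ι ⊕ ι) ι ℂ) : Prop where
  hamiltonian : IsHamiltonian H
  symplectic : IsSymplectic S
  canonical : S⁻¹ * H * S = J
  hermitian : W₀.IsHermitian
  initial : Y 0 = fromRows 1 W₀
  ode : ∀ (t : ℝ) (i : ι ⊕ ι) (j : ι), HasDerivAt (fun s => Y s i j) ((H * Y t) i j) t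

/-- The upper half `Q(t)` of `Y(t)`. -/
def flowQ {ι : Type} (Y : ℝ → Matrix (ι ⊕ ι) ι ℂ) (t : ℝ) : Matrix ι ι ℂ := (Y t).toRows₁

/-- The lower half `P(t)` of `Y(t)`. -/
def flowP {ι : Type} (Y : ℝ → Matrix (ι ⊕ ι) ι ℂ) (t : ℝ) : Matrix ι ι ℂ := (Y t).toRows₂

/-- The extended Riccati solution `W(t) = P(t) Q(t)⁻¹`, meaningful where `Q(t)` is invertible. -/
def flowW {ι : Type} [Fintype ι] [DecidableEq ι] (Y : ℝ → Matrix (ι ⊕ ι) ι ℂ) (t : ℝ) :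
    Matrix ι ι ℂ :=
  flowP Y t * (flowQ Y t)⁻¹

/-- `W₁`, the upper half of `S⁻¹ [I; W₀]`. -/
def coordW₁ {ι : Type} [Fintype ι] [DecidableEq ι]
    (S : Matrix (ι ⊕ ι) (ι ⊕ ι) ℂ) (W₀ : Matrix ι ι ℂ) : Matrix ι ι ℂ :=
  (S⁻¹ * fromRows 1 W₀).toRows₁

/-- `W₂`, the lower half of `S⁻¹ [I; W₀]`. -/
def coordW₂ {ι : Type} [Fintype ι] [DecidableEq ι]
    (S : Matrix (ι ⊕ ι) (ι ⊕ ι) ℂ) (W₀ : Matrix ι ι ℂ) : Matrix ι ι ℂ :=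
  (S⁻¹ * fromRows 1 W₀).toRows₂

/-! ### Constants of the limits for types `c` and `d` -/

/-- The lower right entry `w` of `W₁ W₂⁻¹`. -/
def cornerW {n₁ n₂ : ℕ} (S : Matrix (Idx n₁ n₂ ⊕ Idx n₁ n₂) (Idx n₁ n₂ ⊕ Idx n₁ n₂) ℂ)
    (W₀ : Matrix (Idx n₁ n₂) (Idx n₁ n₂) ℂ) : ℂ :=
  (coordW₁ S W₀ * (coordW₂ S W₀)⁻¹) (Sum.inr ()) (Sum.inr ())

/-- `f_u = (1/2) (-1)^{n₁} (w - iβ)`. -/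
def fu (n₁ : ℕ) (β w : ℂ) : ℂ := 1 / 2 * ((-1) ^ n₁ * (w - Complex.I * β))

/-- `f_v = (1/2) (-1)^{n₁} (iβw + 1)`. -/
def fv (n₁ : ℕ) (β w : ℂ) : ℂ := 1 / 2 * ((-1) ^ n₁ * (Complex.I * β * w + 1))

/-- `g_u = (1/2) (-1)^{n₂} (w + iβ)`. -/
def gu (n₂ : ℕ) (β w : ℂ) : ℂ := 1 / 2 * ((-1) ^ n₂ * (w + Complex.I * β))

/-- `g_v = (1/2) (-1)^{n₂} (-iβw + 1)`. -/
def gv (n₂ : ℕ) (β w : ℂ) : ℂ := 1 / 2 * ((-1) ^ n₂ * (-Complex.I * β * w + 1))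

/-- For `A = [U, u]` and `B = [V, v]` with last columns `u`, `v`: the column `a u + b v`. -/
def mixCol {n₁ n₂ : ℕ} (A B : Matrix (Idx n₁ n₂) (Idx n₁ n₂) ℂ) (a b : ℂ) :
    Matrix (Idx n₁ n₂) Unit ℂ :=
  a • A.toCols₂ + b • B.toCols₂

/-- For `A = [U, u]` and `B = [V, v]` with last columns `u`, `v`: the matrix `[U, a u + b v]`. -/
def mixMat {n₁ n₂ : ℕ} (A B : Matrix (Idx n₁ n₂) (Idx n₁ n₂) ℂ) (a b : ℂ) :
    Matrix (Idx n₁ n₂) (Idx n₁ n₂) ℂ :=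
  fromCols A.toCols₁ (mixCol A B a b)

/-- The last unit vector `e_n`, `n = n₁ + n₂ + 1`, as a column. -/
def eLast (n₁ n₂ : ℕ) : Matrix (Idx n₁ n₂) Unit ℂ := fromRows 0 1

/-! ### Asymptotic notation -/

/-- The filter for `t → ±∞`. -/
def pmInfty : Filter ℝ := atBot ⊔ atTop

/-- `M(t) = O(g(t))` along `l`, for a matrix function `M` (entrywise, which for matrices of fixed
size is the same as in any norm). -/
def MatBigO {m n : Type} (l : Filter ℝ) (M : ℝ → Matrix m n ℂ) (g : ℝ → ℝ) : Prop :=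
  ∀ i j, (fun t => M t i j) =O[l] g

end HamRiccati

end

/-!
# Asymptotics of extended Riccati solutions for elementary Hamiltonian Jordan blocks

In the coordinates `S⁻¹ Y = [x; y]` the flow is that of the canonical block. Reversing the order of
the rows of `y`, with alternating signs, turns this block into one upper triangular Jordan block
(type `e`), into two such blocks with the eigenvalues `λ` and `-conj λ` (type `r`), or, in terms of
the combinations `√2/2 (-x ± iβ y)` of the last coordinates, into two Jordan chains of odd lengths
`2 n₁ + 1` and `2 n₂ + 1` with eigenvalues `iγ` and `iδ` (type `d`; type `c` is the case
`γ = δ = η`). A Jordan chain `z_k' = ω z_k + z_{k+1}` is solved explicitly by divided powers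
`t ^ k / k!` (`chain_solution`).

The quotient `W = P Q⁻¹` does not change when the columns of `Y` are recombined by an invertible
matrix `R(t)`, and `Q⁻¹ = R (Q R)⁻¹`. So it is enough to choose `R(t)` such that `Y R` tends to a
matrix with known blocks.

* For type `r`, `R` is chosen such that the growing coordinates of `S⁻¹ Y R` are the identity
  matrix; the decaying ones are then `O(e^{-2 Re λ |t|} |t|^{2 (n - 1)})`.
* For the chains with imaginary eigenvalues, `R(t)` is chosen by solving a boundary value problem:
  the initial value of `y` is determined from the value of the first `n` entries of the chain at
  time `t`. The block of the matrix exponential that has to be inverted is homogeneous in `t`: up to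
  powers of `t` it is the constant matrix with entries `1 / (n + g + j - i)!`, with `g = 0, 1` for
  chains of even and odd length. It is invertible because a vector in its kernel would give a
  nonzero polynomial with too many zeros at `0` and `1` (`isUnit_divPowMat_top_bot`). All solution
  operators of the boundary value problem are `O(1 / t)`, except that the middle entry of an odd
  chain is multiplied by `(-1) ^ n e^{ωt}` (`divPowMat_corner`); this is the source of the constants
  `f_u, f_v, g_u, g_v`. The coupling of `x(0)` to `y(0)` through `W₁ W₂⁻¹` is an `O(1 / t)`
  perturbation (`fixedPoint_asymptotics`).

For types `c` and `d` this gives `Q R = U₁ + e^{iθt} ζ₁ e_nᴴ + O(1 / t)`, and likewise for `P`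
(`IsFlow.exists_multiplier`). For type `c`, `θ = 0` and one inverts the limit; for type `d` the
Sherman–Morrison formula (`rankOne_quotient_asymptotics`) produces the scalar denominator. Finally
`|c| = 1` and `rank K_W = 1` because the vector `[ζ₁; ζ₂] - [U₁; U₂] U₁⁻¹ ζ₁` is nonzero and has
vanishing upper half, hence is isotropic for the symplectic form (`norm_corner_eq_one`); here the
corner entry `w` is real since `W₁ W₂⁻¹` is Hermitian.
-/

noncomputable section

namespace HamRiccati

/-! ### Calculus of entrywise asymptotics for matrix functions -/

section Calculus

variable {l : Filter ℝ} {m n k : Type}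

lemma MatBigO.add {M N : ℝ → Matrix m n ℂ} {g : ℝ → ℝ} (hM : MatBigO l M g)
    (hN : MatBigO l N g) : MatBigO l (fun t => M t + N t) g :=
  fun i j => (hM i j).add (hN i j)

lemma MatBigO.sub {M N : ℝ → Matrix m n ℂ} {g : ℝ → ℝ} (hM : MatBigO l M g)
    (hN : MatBigO l N g) : MatBigO l (fun t => M t - N t) g :=
  fun i j => (hM i j).sub (hN i j)

lemma MatBigO.neg {M : ℝ → Matrix m n ℂ} {g : ℝ → ℝ} (hM : MatBigO l M g) :
    MatBigO l (fun t => -M t) g :=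
  fun i j => (hM i j).neg_left

lemma MatBigO.mul [Fintype n] {M : ℝ → Matrix m n ℂ} {N : ℝ → Matrix n k ℂ} {g h : ℝ → ℝ}
    (hM : MatBigO l M g) (hN : MatBigO l N h) :
    MatBigO l (fun t => M t * N t) (fun t => g t * h t) := by
  intro i j
  simp only [Matrix.mul_apply]
  exact IsBigO.fun_sum fun x _ => (hM i x).mul (hN x j)

lemma MatBigO.const (M : Matrix m n ℂ) : MatBigO l (fun _ => M) (fun _ => (1 : ℝ)) :=
  fun _ _ => isBigO_const_const _ one_ne_zero _

lemma MatBigO.smul {f : ℝ → ℂ} {M : ℝ → Matrix m n ℂ} {g h : ℝ → ℝ} (hf : f =O[l] g)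
    (hM : MatBigO l M h) : MatBigO l (fun t => f t • M t) (fun t => g t * h t) :=
  fun i j => hf.mul (hM i j)

lemma MatBigO.congr' {M N : ℝ → Matrix m n ℂ} {g : ℝ → ℝ} (hM : MatBigO l M g)
    (h : ∀ᶠ t in l, M t = N t) : MatBigO l N g :=
  fun i j => (hM i j).congr' (h.mono fun _ ht => congrFun (congrFun ht i) j) EventuallyEq.rfl

lemma MatBigO.trans {M : ℝ → Matrix m n ℂ} {g h : ℝ → ℝ} (hM : MatBigO l M g)
    (hg : g =O[l] h) : MatBigO l M h :=
  fun i j => (hM i j).trans hg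

lemma MatBigO.bounded_mul [Fintype n] {M : ℝ → Matrix m n ℂ} {N : ℝ → Matrix n k ℂ} {g : ℝ → ℝ}
    (hM : MatBigO l M fun _ => (1 : ℝ)) (hN : MatBigO l N g) : MatBigO l (fun t => M t * N t) g := by
  simpa using hM.mul hN

lemma MatBigO.mul_bounded [Fintype n] {M : ℝ → Matrix m n ℂ} {N : ℝ → Matrix n k ℂ} {g : ℝ → ℝ}
    (hM : MatBigO l M g) (hN : MatBigO l N fun _ => (1 : ℝ)) : MatBigO l (fun t => M t * N t) g := by
  simpa using hM.mul hN

lemma MatBigO.const_mul [Fintype n] (A : Matrix m n ℂ) {M : ℝ → Matrix n k ℂ} {g : ℝ → ℝ}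
    (hM : MatBigO l M g) : MatBigO l (fun t => A * M t) g :=
  (MatBigO.const A).bounded_mul hM

lemma MatBigO.mul_const [Fintype n] {M : ℝ → Matrix m n ℂ} {g : ℝ → ℝ}
    (hM : MatBigO l M g) (A : Matrix n k ℂ) : MatBigO l (fun t => M t * A) g :=
  hM.mul_bounded (MatBigO.const A)

lemma MatBigO.bounded_smul {f : ℝ → ℂ} {M : ℝ → Matrix m n ℂ} {g : ℝ → ℝ}
    (hf : f =O[l] fun _ => (1 : ℝ)) (hM : MatBigO l M g) : MatBigO l (fun t => f t • M t) g := by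
  simpa using MatBigO.smul hf hM

lemma MatBigO.bounded_of_sub {M : ℝ → Matrix m n ℂ} {M₀ : Matrix m n ℂ} {g : ℝ → ℝ}
    (hM : MatBigO l (fun t => M t - M₀) g) (hg : g =O[l] fun _ => (1 : ℝ)) :
    MatBigO l M fun _ => (1 : ℝ) := by
  simpa using (hM.trans hg).add (MatBigO.const M₀)

lemma MatBigO.tendsto {M : ℝ → Matrix m n ℂ} {M₀ : Matrix m n ℂ} {g : ℝ → ℝ}
    (hM : MatBigO l (fun t => M t - M₀) g) (hg : Tendsto g l (nhds 0)) :
    Tendsto M l (nhds M₀) := by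
  refine tendsto_pi_nhds.2 fun i => tendsto_pi_nhds.2 fun j => ?_
  have h := (hM i j).trans_tendsto hg
  simpa using h.add_const (M₀ i j)

/-- Inversion is locally Lipschitz at an invertible matrix. -/
lemma MatBigO.inv_sub [Fintype n] [DecidableEq n] {M : ℝ → Matrix n n ℂ} {M₀ : Matrix n n ℂ}
    {g : ℝ → ℝ} (hM : MatBigO l (fun t => M t - M₀) g) (hg : Tendsto g l (nhds 0))
    (h₀ : IsUnit M₀) :
    (∀ᶠ t in l, IsUnit (M t)) ∧ MatBigO l (fun t => (M t)⁻¹ - M₀⁻¹) g := by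
  have hlim := hM.tendsto hg
  have hdet₀ : M₀.det ≠ 0 := ((Matrix.isUnit_iff_isUnit_det _).1 h₀).ne_zero
  have hdet : Tendsto (fun t => (M t).det) l (nhds M₀.det) :=
    ((continuous_id.matrix_det (A := fun A : Matrix n n ℂ => A)).tendsto M₀).comp hlim
  have hadj : Tendsto (fun t => (M t).adjugate) l (nhds M₀.adjugate) :=
    ((continuous_id.matrix_adjugate (A := fun A : Matrix n n ℂ => A)).tendsto M₀).comp hlim
  have hunit : ∀ᶠ t in l, IsUnit (M t) := by
    filter_upwards [hdet.eventually_ne hdet₀] with t ht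
    exact (Matrix.isUnit_iff_isUnit_det _).2 ht.isUnit
  have hinv : Tendsto (fun t => (M t)⁻¹) l (nhds M₀⁻¹) := by
    simp only [Matrix.inv_def, Ring.inverse_eq_inv']
    exact (hdet.inv₀ hdet₀).smul hadj
  have hbdd : MatBigO l (fun t => (M t)⁻¹) fun _ => (1 : ℝ) := fun i j =>
    (tendsto_pi_nhds.1 (tendsto_pi_nhds.1 hinv i) j).isBigO_one ℝ
  refine ⟨hunit, ((hbdd.bounded_mul hM.neg).mul_const M₀⁻¹).congr' ?_⟩
  filter_upwards [hunit] with t ht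
  rw [neg_sub, Matrix.mul_sub, Matrix.sub_mul,
    Matrix.nonsing_inv_mul _ ((Matrix.isUnit_iff_isUnit_det _).1 ht), Matrix.mul_assoc,
    Matrix.mul_nonsing_inv _ ((Matrix.isUnit_iff_isUnit_det _).1 h₀)]
  simp

lemma MatBigO.mul_sub_mul [Fintype n] {M : ℝ → Matrix m n ℂ} {N : ℝ → Matrix n k ℂ}
    {M₀ : Matrix m n ℂ} {N₀ : Matrix n k ℂ} {g : ℝ → ℝ}
    (hM : MatBigO l (fun t => M t - M₀) g) (hN : MatBigO l (fun t => N t - N₀) g)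
    (hg : g =O[l] fun _ => (1 : ℝ)) : MatBigO l (fun t => M t * N t - M₀ * N₀) g := by
  refine ((hM.mul_bounded (hN.bounded_of_sub hg)).add (hN.const_mul M₀)).congr'
    (Eventually.of_forall fun t => ?_)
  simp only [Matrix.sub_mul, Matrix.mul_sub]
  abel

/-- If `Q R` and `P R` converge with rate `g` to `U₁` and `U₂`, with `R` and `U₁` invertible, then
`P Q⁻¹` converges with the same rate to `U₂ U₁⁻¹`, and `Q⁻¹ = R (Q R)⁻¹`. -/
lemma quotient_asymptotics [Fintype n] [DecidableEq n] {Q P R : ℝ → Matrix n n ℂ}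
    {U₁ U₂ : Matrix n n ℂ} {g : ℝ → ℝ} (hg : Tendsto g l (nhds 0))
    (hQ : MatBigO l (fun t => Q t * R t - U₁) g) (hP : MatBigO l (fun t => P t * R t - U₂) g)
    (hR : ∀ᶠ t in l, IsUnit (R t)) (hU : IsUnit U₁) :
    (∀ᶠ t in l, IsUnit (Q t)) ∧ MatBigO l (fun t => P t * (Q t)⁻¹ - U₂ * U₁⁻¹) g ∧
      (∀ᶠ t in l, (Q t)⁻¹ = R t * (Q t * R t)⁻¹) ∧
      MatBigO l (fun t => (Q t * R t)⁻¹ - U₁⁻¹) g := by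
  obtain ⟨hunit, hinv⟩ := hQ.inv_sub hg hU
  have hQinv : ∀ᶠ t in l, (Q t)⁻¹ = R t * (Q t * R t)⁻¹ := by
    filter_upwards [hR] with t ht
    rw [Matrix.mul_inv_rev, ← Matrix.mul_assoc,
      Matrix.mul_nonsing_inv _ ((Matrix.isUnit_iff_isUnit_det _).1 ht), Matrix.one_mul]
  refine ⟨?_, ?_, hQinv, hinv⟩
  · filter_upwards [hunit] with t ht
    rw [Matrix.isUnit_iff_isUnit_det, Matrix.det_mul] at ht
    exact (Matrix.isUnit_iff_isUnit_det _).2 (isUnit_of_mul_isUnit_left ht)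
  · refine (hP.mul_sub_mul hinv (hg.isBigO_one ℝ)).congr' ?_
    filter_upwards [hQinv] with t ht
    rw [ht, Matrix.mul_assoc]

end Calculus

lemma tendsto_inv_pmInfty : Tendsto (fun t : ℝ => t⁻¹) pmInfty (nhds 0) :=
  tendsto_inv_atBot_zero.sup tendsto_inv_atTop_zero

lemma isBigO_inv_pmInfty : (fun t : ℝ => t⁻¹) =O[pmInfty] fun _ => (1 : ℝ) :=
  tendsto_inv_pmInfty.isBigO_one ℝ

lemma eventually_pmInfty_one_le_abs : ∀ᶠ t : ℝ in pmInfty, 1 ≤ |t| :=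
  eventually_sup.2 ⟨tendsto_abs_atBot_atTop.eventually_ge_atTop 1,
    tendsto_abs_atTop_atTop.eventually_ge_atTop 1⟩

lemma isBigO_cexp_I (a : ℝ) (l : Filter ℝ) :
    (fun t : ℝ => Complex.exp (Complex.I * a * t)) =O[l] fun _ => (1 : ℝ) := by
  refine IsBigO.of_bound 1 (Eventually.of_forall fun t => ?_)
  have : Complex.I * a * t = ((a * t : ℝ) : ℂ) * Complex.I := by push_cast; ring
  rw [this, Complex.norm_exp_ofReal_mul_I]
  simp

/-! ### Divided powers and Jordan chains -/

/-- The divided power `t ^ k / k!`, extended by zero to negative `k`, so that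
differentiation in `t` always lowers `k` by one. -/
def divPow (k : ℤ) (t : ℝ) : ℂ := if 0 ≤ k then (t : ℂ) ^ k.toNat / (k.toNat).factorial else 0

lemma divPow_natCast (k : ℕ) (t : ℝ) : divPow k t = (t : ℂ) ^ k / k.factorial := by
  simp [divPow]

lemma divPow_of_neg {k : ℤ} (hk : k < 0) (t : ℝ) : divPow k t = 0 := by
  simp [divPow, not_le.2 hk]

lemma divPow_zero_right (k : ℤ) : divPow k 0 = if k = 0 then 1 else 0 := by
  rcases lt_or_ge k 0 with hk | hk
  · rw [divPow_of_neg hk, if_neg hk.ne]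
  · lift k to ℕ using hk
    rw [divPow_natCast]
    rcases k with _ | k <;> simp
    omega

lemma hasDerivAt_divPow (k : ℤ) (t : ℝ) : HasDerivAt (divPow k) (divPow (k - 1) t) t := by
  rcases lt_or_ge k 0 with hk | hk
  · rw [divPow_of_neg (by omega : k - 1 < 0), funext (divPow_of_neg hk)]
    exact hasDerivAt_const _ _
  · lift k to ℕ using hk
    rw [funext (divPow_natCast k)]
    rcases k with _ | k
    · simpa [divPow_of_neg] using hasDerivAt_const t (1 : ℂ)
    · have h := ((hasDerivAt_id (t : ℂ)).pow (k + 1)).comp_ofReal.div_const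
        ((k + 1).factorial : ℂ)
      have e : ((k + 1 : ℕ) : ℤ) - 1 = (k : ℕ) := by push_cast; ring
      rw [e, divPow_natCast]
      refine h.congr_deriv ?_
      have h1 : ((k : ℂ) + 1) ≠ 0 := by exact_mod_cast k.succ_ne_zero
      have h2 : (k.factorial : ℂ) ≠ 0 := by exact_mod_cast k.factorial_ne_zero
      simp only [Nat.factorial_succ, id, Nat.add_sub_cancel]
      push_cast
      field_simp

lemma divPow_eq_zpow_mul (k : ℤ) (t : ℝ) :
    divPow k t = (t : ℂ) ^ k * divPow k 1 := by
  rcases lt_or_ge k 0 with hk | hk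
  · simp [divPow_of_neg hk]
  · lift k to ℕ using hk
    simp [divPow_natCast, div_eq_mul_inv]

/-- The solution of `z_k' = ω z_k + z_{k+1}`, `k < m`, `z_m = 0`. -/
lemma chain_solution {m : ℕ} {ω : ℂ} {z : ℕ → ℝ → ℂ} (hz : ∀ k, m ≤ k → ∀ t, z k t = 0)
    (hd : ∀ k < m, ∀ t, HasDerivAt (z k) (ω * z k t + z (k + 1) t) t) {k : ℕ} (hk : k ≤ m)
    (t : ℝ) :
    z k t = Complex.exp (ω * t) * ∑ l ∈ Finset.range m, divPow (l - k) t * z l 0 := by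
  -- after removal of the exponential factor, the difference `u` of the two sides satisfies
  -- `u_k' = u_{k+1}`, `u_k 0 = 0` and `u_m = 0`
  set u : ℕ → ℝ → ℂ := fun k t =>
    Complex.exp (-(ω * t)) * z k t - ∑ l ∈ Finset.range m, divPow (l - k) t * z l 0 with hu
  have hderiv : ∀ k < m, ∀ t, HasDerivAt (u k) (u (k + 1) t) t := by
    intro k hk t
    have h1 : HasDerivAt (fun t : ℝ => Complex.exp (-(ω * t)))
        (Complex.exp (-(ω * t)) * (-ω)) t := by
      have h0 : HasDerivAt (fun t : ℝ => -(ω * (t : ℂ))) (-ω) t := by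
        simpa using (hasDerivAt_id (t : ℂ)).comp_ofReal.const_mul (-ω)
      exact h0.cexp
    have h2 := h1.mul (hd k hk t)
    have h3 : HasDerivAt (fun t => ∑ l ∈ Finset.range m, divPow (l - k) t * z l 0)
        (∑ l ∈ Finset.range m, divPow (l - k - 1) t * z l 0) t :=
      HasDerivAt.fun_sum fun l _ => (hasDerivAt_divPow _ t).mul_const _
    refine (h2.sub h3).congr_deriv ?_
    simp only [hu]
    push_cast
    simp only [sub_add_eq_sub_sub]
    ring
  have hinit : ∀ k < m, u k 0 = 0 := by
    intro k hk
    simp only [hu, divPow_zero_right, sub_eq_zero, Nat.cast_inj]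
    simp [hk]
  have hzero : ∀ j ≤ m, ∀ t, u (m - j) t = 0 := by
    intro j
    induction j with
    | zero =>
      intro _ t
      simp only [hu, Nat.sub_zero, hz m le_rfl, mul_zero, zero_sub, neg_eq_zero]
      refine Finset.sum_eq_zero fun l hl => ?_
      rw [divPow_of_neg (by have := Finset.mem_range.1 hl; omega), zero_mul]
    | succ j ih =>
      intro hj t
      have e : m - (j + 1) + 1 = m - j := by omega
      have hlt : m - (j + 1) < m := by omega
      have hd0 : ∀ t, HasDerivAt (u (m - (j + 1))) 0 t := fun t => by
        have := hderiv _ hlt t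
        rwa [e, ih (by omega)] at this
      rw [← hinit _ hlt]
      exact is_const_of_deriv_eq_zero (fun t => (hd0 t).differentiableAt)
        (fun t => (hd0 t).deriv) _ _
  have h := hzero (m - k) (by omega) t
  rw [show m - (m - k) = k by omega, hu] at h
  rw [← sub_eq_zero.1 h, ← mul_assoc, ← Complex.exp_add]
  simp

/-! ### Homogeneous matrix functions -/

section Homogeneous

variable {m n k : Type}

/-- The matrix function with entries `t ^ (q j - p i) * M i j`. -/
def graded (p : m → ℤ) (q : n → ℤ) (M : Matrix m n ℂ) (t : ℝ) : Matrix m n ℂ :=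
  of fun i j => (t : ℂ) ^ (q j - p i) * M i j

/-- The block with row positions `p` and column positions `q` of the exponential of `t` times a
nilpotent Jordan block. -/
def divPowMat (p : m → ℤ) (q : n → ℤ) (t : ℝ) : Matrix m n ℂ :=
  of fun i j => divPow (q j - p i) t

lemma divPowMat_eq_graded (p : m → ℤ) (q : n → ℤ) (t : ℝ) :
    divPowMat p q t = graded p q (divPowMat p q 1) t := by
  ext i j
  exact divPow_eq_zpow_mul _ t

lemma graded_mul [Fintype n] (p : m → ℤ) (q : n → ℤ) (r : k → ℤ) (M : Matrix m n ℂ)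
    (N : Matrix n k ℂ) {t : ℝ} (ht : t ≠ 0) :
    graded p q M t * graded q r N t = graded p r (M * N) t := by
  have ht' : (t : ℂ) ≠ 0 := by exact_mod_cast ht
  ext i j
  simp only [graded, Matrix.mul_apply, of_apply, Finset.mul_sum]
  refine Finset.sum_congr rfl fun x _ => ?_
  rw [show r j - p i = (q x - p i) + (r j - q x) by ring, zpow_add₀ ht']
  ring

lemma graded_one [DecidableEq m] (p : m → ℤ) (t : ℝ) : graded p p 1 t = 1 := by
  ext i j
  rcases eq_or_ne i j with rfl | h <;> simp [graded, *]

lemma graded_bigO (p : m → ℤ) (q : n → ℤ) (M : Matrix m n ℂ) (h : ∀ i j, q j - p i ≤ -1) :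
    MatBigO pmInfty (graded p q M) fun t => t⁻¹ := by
  intro i j
  refine IsBigO.of_bound ‖M i j‖ ?_
  filter_upwards [eventually_pmInfty_one_le_abs] with t ht
  simp only [graded, of_apply, norm_mul, norm_zpow, Complex.norm_real, Real.norm_eq_abs, norm_inv]
  rw [mul_comm, ← _root_.zpow_neg_one |t|]
  exact mul_le_mul_of_nonneg_left (zpow_le_zpow_right₀ ht (h i j)) (norm_nonneg _)

end Homogeneous

/-! ### The two-point boundary problem for a Jordan chain -/

/-- Positions in the chain `x_0, …, x_{n-1}, p_0, …, p_{g-1}, y_0, …, y_{n-1}` of the `x_i`. -/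
def topPos (n : ℕ) (i : Fin n) : ℤ := (i : ℕ)

/-- Positions in the chain `x_0, …, x_{n-1}, p_0, …, p_{g-1}, y_0, …, y_{n-1}` of the `p_i`. -/
def midPos (n g : ℕ) (i : Fin g) : ℤ := n + (i : ℕ)

/-- Positions in the chain `x_0, …, x_{n-1}, p_0, …, p_{g-1}, y_0, …, y_{n-1}` of the `y_i`. -/
def botPos (n g : ℕ) (i : Fin n) : ℤ := n + g + (i : ℕ)

open Polynomial in
lemma eval_one_iterate_derivative_divPow (N k : ℕ) (a : ℂ) :
    (derivative^[k] (C (a / N.factorial) * X ^ N)).eval 1 = a * divPow (N - k) 1 := by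
  rw [iterate_derivative_C_mul, iterate_derivative_X_pow_eq_C_mul]
  simp only [eval_mul, eval_C, eval_pow, eval_X, one_pow, mul_one]
  have hN : (N.factorial : ℂ) ≠ 0 := by exact_mod_cast N.factorial_ne_zero
  rcases le_or_gt k N with h | h
  · rw [← Nat.cast_sub h, divPow_natCast]
    have h1 : ((N - k).factorial : ℂ) ≠ 0 := by exact_mod_cast (N - k).factorial_ne_zero
    have h2 : ((N - k).factorial : ℂ) * N.descFactorial k = N.factorial := by
      exact_mod_cast Nat.factorial_mul_descFactorial h
    rw [← h2] at hN ⊢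
    have h3 := right_ne_zero_of_mul hN
    simp only [Complex.ofReal_one, one_pow]
    field_simp
  · rw [Nat.descFactorial_eq_zero_iff_lt.2 h, divPow_of_neg (by omega)]
    simp

open Polynomial in
/-- A polynomial with a zero of order at least `n + g` at `0` whose first `n` derivatives at `1`
are the entries of `divPowMat (topPos n) (botPos n g) 1 *ᵥ v`. -/
def botPoly (n g : ℕ) (v : Fin n → ℂ) : ℂ[X] :=
  ∑ b : Fin n, C (v b / (n + g + b).factorial) * X ^ (n + g + b)

open Polynomial in
lemma eval_one_iterate_derivative_botPoly (n g k : ℕ) (v : Fin n → ℂ) :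
    (derivative^[k] (botPoly n g v)).eval 1 = ∑ b : Fin n, v b * divPow (botPos n g b - k) 1 := by
  rw [botPoly, iterate_derivative_sum, eval_finsetSum]
  refine Finset.sum_congr rfl fun b _ => ?_
  rw [eval_one_iterate_derivative_divPow]
  simp [botPos]

open Polynomial in
lemma X_pow_dvd_botPoly (n g : ℕ) (v : Fin n → ℂ) : (X : ℂ[X]) ^ (n + g) ∣ botPoly n g v :=
  Finset.dvd_sum fun b _ => Dvd.dvd.mul_left (pow_dvd_pow _ (by omega)) _

open Polynomial in
lemma natDegree_botPoly_le (n g : ℕ) (v : Fin n → ℂ) :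
    (botPoly n g v).natDegree ≤ 2 * n + g - 1 := by
  refine natDegree_sum_le_of_forall_le _ _ fun b _ => ?_
  refine (natDegree_C_mul_X_pow_le _ _).trans ?_
  omega

open Polynomial in
lemma X_sub_one_pow_dvd {p : ℂ[X]} {n : ℕ} (h : ∀ k < n, (derivative^[k] p).eval 1 = 0) :
    (X - C 1) ^ n ∣ p := by
  rcases eq_or_ne p 0 with rfl | hp
  · exact dvd_zero _
  rcases n with _ | n
  · simp
  · refine (le_rootMultiplicity_iff hp).1 ?_
    exact (lt_rootMultiplicity_iff_isRoot_iterate_derivative hp).2 fun k hk => h k (by omega)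

open Polynomial in
lemma X_pow_mul_dvd {p : ℂ[X]} {n m : ℕ} (h₀ : X ^ m ∣ p)
    (h₁ : ∀ k < n, (derivative^[k] p).eval 1 = 0) : X ^ m * (X - C 1) ^ n ∣ p := by
  refine IsCoprime.mul_dvd (IsCoprime.pow ?_) h₀ (X_sub_one_pow_dvd h₁)
  simpa using isCoprime_X_sub_C_of_isUnit_sub (a := (0 : ℂ)) (b := 1) (by simp)

open Polynomial in
lemma natDegree_X_pow_mul (n m : ℕ) :
    ((X : ℂ[X]) ^ m * (X - C 1) ^ n).natDegree = m + n := by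
  rw [natDegree_mul (pow_ne_zero _ X_ne_zero) (pow_ne_zero _ (X_sub_C_ne_zero _)), natDegree_X_pow,
    natDegree_pow, natDegree_X_sub_C, mul_one]

/-- The matrix with entries `1 / (n + g + j - i)!` is invertible: a vector in its kernel yields a
polynomial of degree less than `2 n + g` with zeros of order `n + g` at `0` and `n` at `1`. -/
lemma isUnit_divPowMat_top_bot (n g : ℕ) : IsUnit (divPowMat (topPos n) (botPos n g) 1) := by
  rw [← Matrix.mulVec_injective_iff_isUnit, ← Matrix.coe_mulVecLin, ← LinearMap.ker_eq_bot,
    LinearMap.ker_eq_bot']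
  intro v hv
  have hp : botPoly n g v = 0 := by
    rcases n.eq_zero_or_pos with rfl | hn
    · simp [botPoly]
    by_contra hne
    have hdvd := X_pow_mul_dvd (n := n) (X_pow_dvd_botPoly n g v) fun k hk => by
      have := congrFun hv ⟨k, hk⟩
      rw [eval_one_iterate_derivative_botPoly]
      simpa [Matrix.mulVec, dotProduct, divPowMat, topPos, mul_comm] using this
    have h1 := Polynomial.natDegree_le_of_dvd hdvd hne
    have h2 := natDegree_botPoly_le n g v
    rw [natDegree_X_pow_mul] at h1
    omega
  ext b
  have h := congrArg (fun p => Polynomial.coeff p (n + g + b)) hp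
  simp only [botPoly, Polynomial.finsetSum_coeff, Polynomial.coeff_C_mul,
    Polynomial.coeff_X_pow, Polynomial.coeff_zero, add_right_inj, Fin.val_inj] at h
  simpa [Nat.factorial_ne_zero] using h

open Polynomial in
/-- A polynomial of degree at most `2 n` with zeros of order `n` at `0` and `1` is a multiple of
`(X (X - 1)) ^ n`, hence symmetric about `1 / 2`. -/
lemma eval_one_eq_of_zeros {q : ℂ[X]} {n : ℕ} (hdeg : q.natDegree ≤ 2 * n) (h₀ : X ^ n ∣ q)
    (h₁ : ∀ k < n, (derivative^[k] q).eval 1 = 0) :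
    (derivative^[n] q).eval 1 = (-1) ^ n * (n.factorial * q.coeff n) := by
  have hsymm : q.comp (1 - X) = q := by
    obtain ⟨r, hr⟩ := X_pow_mul_dvd h₀ h₁
    rcases eq_or_ne q 0 with rfl | hq
    · simp
    have hr0 : r ≠ 0 := by rintro rfl; simp at hr; exact hq hr
    have hd := congrArg natDegree hr
    rw [natDegree_mul (fun h => hq (by rw [hr, h, zero_mul]))
      hr0, natDegree_X_pow_mul] at hd
    obtain ⟨κ, rfl⟩ := natDegree_eq_zero.1 (show r.natDegree = 0 by omega)
    rw [hr]
    simp only [mul_comp, pow_comp, X_comp, sub_comp, C_comp, ← mul_pow]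
    congr 2
    simp only [map_one]
    ring
  have h := iterate_derivative_comp_one_sub_X q n
  rw [hsymm] at h
  rw [h]
  simp only [eval_mul, eval_pow, eval_neg, eval_one, eval_comp, eval_sub, eval_X, sub_self]
  rw [← coeff_zero_eq_eval_zero, coeff_iterate_derivative]
  simp [Nat.descFactorial_self]

/-- In a chain of odd length, the boundary conditions `x(0) = 0`, `x(1) = 0` force
`p(1) = (-1) ^ n p(0)`. -/
lemma divPowMat_corner (n : ℕ) :
    divPowMat (midPos n 1) (botPos n 1) 1 * (divPowMat (topPos n) (botPos n 1) 1)⁻¹ *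
      divPowMat (topPos n) (midPos n 1) 1 = (1 - (-1) ^ n : ℂ) • 1 := by
  set A := divPowMat (topPos n) (midPos n 1) 1
  set B := divPowMat (topPos n) (botPos n 1) 1 with hB
  set v : Fin n → ℂ := fun b => (B⁻¹ * A) b 0 with hv
  have hBv : ∀ i, ∑ b, v b * divPow (botPos n 1 b - topPos n i) 1 = divPow (n - topPos n i) 1 := by
    intro i
    have h1 : B * (B⁻¹ * A) = A := Matrix.mul_nonsing_inv_cancel_left _ _
      ((Matrix.isUnit_iff_isUnit_det _).1 (isUnit_divPowMat_top_bot n 1))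
    have h2 := congrFun (congrFun h1 i) 0
    rw [Matrix.mul_apply] at h2
    simpa [hB, hv, A, divPowMat, midPos, mul_comm] using h2
  have hv2 : ∑ b, v b * divPow (botPos n 1 b - n) 1 = 1 - (-1) ^ n := by
    set q : Polynomial ℂ := botPoly n 1 v - Polynomial.C (1 / (n.factorial : ℂ)) * Polynomial.X ^ n
      with hq
    have hev : ∀ k : ℕ, (Polynomial.derivative^[k] q).eval 1 =
        ∑ b, v b * divPow (botPos n 1 b - k) 1 - divPow (n - k) 1 := by
      intro k
      rw [hq, Polynomial.iterate_derivative_sub, Polynomial.eval_sub,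
        eval_one_iterate_derivative_botPoly, eval_one_iterate_derivative_divPow, one_mul]
    have h := eval_one_eq_of_zeros (q := q) (n := n) ?_ ?_ ?_
    · rw [hev] at h
      have hc : q.coeff n = -(1 / n.factorial) := by
        have : (botPoly n 1 v).coeff n = 0 := by
          simp only [botPoly, Polynomial.finsetSum_coeff, Polynomial.coeff_C_mul,
            Polynomial.coeff_X_pow]
          exact Finset.sum_eq_zero fun b _ => by rw [if_neg (by omega), mul_zero]
        simp [hq, this]
      have hn : (n.factorial : ℂ) ≠ 0 := by exact_mod_cast n.factorial_ne_zero
      rw [hc, mul_neg, mul_one_div_cancel hn, sub_self, ← Nat.cast_zero, divPow_natCast] at h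
      simp only [pow_zero, Nat.factorial_zero, Nat.cast_one, div_one] at h
      linear_combination h
    · refine (Polynomial.natDegree_sub_le _ _).trans (max_le ?_ ?_)
      · exact (natDegree_botPoly_le n 1 v).trans (by omega)
      · exact (Polynomial.natDegree_C_mul_X_pow_le _ _).trans (by omega)
    · exact dvd_sub ((pow_dvd_pow _ (by omega)).trans (X_pow_dvd_botPoly n 1 v))
        (Dvd.intro_left _ rfl)
    · intro k hk
      rw [hev, sub_eq_zero]
      exact hBv ⟨k, hk⟩
  ext i j
  obtain rfl : i = 0 := Subsingleton.elim _ _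
  obtain rfl : j = 0 := Subsingleton.elim _ _
  rw [Matrix.mul_assoc, Matrix.mul_apply]
  simpa [hv, divPowMat, midPos, mul_comm] using hv2

/-- `z_0, …, z_{m-1}` is a family, indexed by `c`, of solutions of the Jordan chain
`z_k' = ω z_k + z_{k+1}`, continued by zero. -/
structure IsChain {c : Type} (m : ℕ) (ω : ℂ) (z : ℕ → ℝ → c → ℂ) : Prop where
  zero : ∀ k, m ≤ k → ∀ t j, z k t j = 0
  deriv : ∀ k < m, ∀ t j, HasDerivAt (fun s => z k s j) (ω * z k t j + z (k + 1) t j) t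

section Chain

variable {c d : Type} (n g : ℕ) (z : ℕ → ℝ → c → ℂ)

/-- The rows `x_0, …, x_{n-1}` of a chain. -/
def topRows (t : ℝ) : Matrix (Fin n) c ℂ := of fun i j => z i t j

/-- The rows `p_0, …, p_{g-1}` of a chain. -/
def midRows (t : ℝ) : Matrix (Fin g) c ℂ := of fun i j => z (n + i) t j

/-- The rows `y_0, …, y_{n-1}` of a chain. -/
def botRows (t : ℝ) : Matrix (Fin n) c ℂ := of fun i j => z (n + g + i) t j

variable {n g z} {ω : ℂ}

lemma IsChain.apply_eq (h : IsChain (n + g + n) ω z) {k : ℕ} (hk : k ≤ n + g + n) (t : ℝ) (j : c) :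
    z k t j = Complex.exp (ω * t) *
      (∑ i : Fin n, divPow (topPos n i - k) t * topRows n z 0 i j +
        ∑ i : Fin g, divPow (midPos n g i - k) t * midRows n g z 0 i j +
        ∑ i : Fin n, divPow (botPos n g i - k) t * botRows n g z 0 i j) := by
  have := chain_solution (z := fun k t => z k t j) (fun k hk t => h.zero k hk t j)
    (fun k hk t => h.deriv k hk t j) hk t
  rw [this, Finset.sum_range_add, Finset.sum_range_add, Finset.sum_range, Finset.sum_range,
    Finset.sum_range]
  simp [topPos, midPos, botPos, topRows, midRows, botRows]

lemma IsChain.topRows_eq (h : IsChain (n + g + n) ω z) (t : ℝ) :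
    topRows n z t = Complex.exp (ω * t) •
      (divPowMat (topPos n) (topPos n) t * topRows n z 0 +
        divPowMat (topPos n) (midPos n g) t * midRows n g z 0 +
        divPowMat (topPos n) (botPos n g) t * botRows n g z 0) := by
  ext i j
  refine (h.apply_eq (by omega : (i : ℕ) ≤ n + g + n) t j).trans ?_
  simp [Matrix.mul_apply, divPowMat, topPos]

lemma IsChain.midRows_eq (h : IsChain (n + g + n) ω z) (t : ℝ) :
    midRows n g z t = Complex.exp (ω * t) •
      (divPowMat (midPos n g) (midPos n g) t * midRows n g z 0 +
        divPowMat (midPos n g) (botPos n g) t * botRows n g z 0) := by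
  ext i j
  refine (h.apply_eq (by omega : n + (i : ℕ) ≤ n + g + n) t j).trans ?_
  rw [Finset.sum_eq_zero (s := (Finset.univ : Finset (Fin n))) (f := fun l =>
    divPow (topPos n l - _) t * _)]
  · simp [Matrix.mul_apply, divPowMat, midPos]
  · intro l _
    rw [divPow_of_neg (by simp only [topPos]; omega), zero_mul]

lemma IsChain.botRows_eq (h : IsChain (n + g + n) ω z) (t : ℝ) :
    botRows n g z t = Complex.exp (ω * t) •
      (divPowMat (botPos n g) (botPos n g) t * botRows n g z 0) := by
  ext i j
  refine (h.apply_eq (by omega : n + g + (i : ℕ) ≤ n + g + n) t j).trans ?_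
  rw [Finset.sum_eq_zero (s := (Finset.univ : Finset (Fin n))) (f := fun l =>
    divPow (topPos n l - _) t * _), Finset.sum_eq_zero (s := (Finset.univ : Finset (Fin g)))]
  · simp [Matrix.mul_apply, divPowMat, botPos]
  · intro l _
    rw [divPow_of_neg (by simp only [midPos]; omega), zero_mul]
  · intro l _
    rw [divPow_of_neg (by simp only [topPos]; omega), zero_mul]

variable (n g) in
/-- The inverse of the block `divPowMat (topPos n) (botPos n g) t`, for `t ≠ 0`. -/
def botInv (t : ℝ) : Matrix (Fin n) (Fin n) ℂ :=
  graded (botPos n g) (topPos n) (divPowMat (topPos n) (botPos n g) 1)⁻¹ t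

lemma divPowMat_mul_botInv {t : ℝ} (ht : t ≠ 0) :
    divPowMat (topPos n) (botPos n g) t * botInv n g t = 1 := by
  rw [divPowMat_eq_graded, botInv, graded_mul _ _ _ _ _ ht, Matrix.mul_nonsing_inv _
    ((Matrix.isUnit_iff_isUnit_det _).1 (isUnit_divPowMat_top_bot n g)), graded_one]

lemma isUnit_botInv {t : ℝ} (ht : t ≠ 0) : IsUnit (botInv n g t) :=
  IsUnit.of_mul_eq_one_right _ (divPowMat_mul_botInv ht)

lemma eventually_pmInfty_ne_zero : ∀ᶠ t : ℝ in pmInfty, t ≠ 0 := by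
  filter_upwards [eventually_pmInfty_one_le_abs] with t ht h
  norm_num [h] at ht

lemma botInv_bigO : MatBigO pmInfty (botInv n g) fun t => t⁻¹ :=
  graded_bigO _ _ _ fun i j => by simp only [botPos, topPos]; omega

lemma botInv_mul_bigO {m : Type} (q : m → ℤ) (hq : ∀ i, q i ≤ n + g - 1) :
    MatBigO pmInfty (fun t => botInv n g t * divPowMat (topPos n) q t) fun t => t⁻¹ := by
  refine (graded_bigO (botPos n g) q ((divPowMat (topPos n) (botPos n g) 1)⁻¹ *
    divPowMat (topPos n) q 1) fun i j => ?_).congr' ?_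
  · have := hq j
    simp only [botPos]; omega
  · filter_upwards [eventually_pmInfty_ne_zero] with t ht
    rw [divPowMat_eq_graded _ _ t, botInv, graded_mul _ _ _ _ _ ht]

lemma mul_botInv_bigO {m : Type} (p : m → ℤ) (hp : ∀ i, (n : ℤ) ≤ p i) :
    MatBigO pmInfty (fun t => divPowMat p (botPos n g) t * botInv n g t) fun t => t⁻¹ := by
  refine (graded_bigO p (topPos n) (divPowMat p (botPos n g) 1 *
    (divPowMat (topPos n) (botPos n g) 1)⁻¹) fun i j => ?_).congr' ?_
  · have := hp i
    simp only [topPos]; omega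
  · filter_upwards [eventually_pmInfty_ne_zero] with t ht
    rw [divPowMat_eq_graded _ _ t, botInv, graded_mul _ _ _ _ _ ht]

lemma mul_botInv_mul_bigO {m k : Type} (p : m → ℤ) (q : k → ℤ) (h : ∀ i j, q j - p i ≤ -1) :
    MatBigO pmInfty (fun t => divPowMat p (botPos n g) t * botInv n g t *
      divPowMat (topPos n) q t) fun t => t⁻¹ := by
  refine (graded_bigO p q (divPowMat p (botPos n g) 1 *
    (divPowMat (topPos n) (botPos n g) 1)⁻¹ * divPowMat (topPos n) q 1) h).congr' ?_
  filter_upwards [eventually_pmInfty_ne_zero] with t ht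
  rw [divPowMat_eq_graded _ (botPos n g) t, divPowMat_eq_graded _ q t, botInv,
    graded_mul _ _ _ _ _ ht, graded_mul _ _ _ _ _ ht]

lemma mid_botInv_mid {t : ℝ} (ht : t ≠ 0) :
    divPowMat (midPos n 1) (botPos n 1) t * botInv n 1 t * divPowMat (topPos n) (midPos n 1) t =
      (1 - (-1) ^ n : ℂ) • 1 := by
  rw [divPowMat_eq_graded _ (botPos n 1) t, divPowMat_eq_graded _ (midPos n 1) t, botInv,
    graded_mul _ _ _ _ _ ht, graded_mul _ _ _ _ _ ht, divPowMat_corner]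
  ext i j
  obtain rfl : i = j := Subsingleton.elim _ _
  simp [graded]

/-- The combination `R(t)` of the solutions of a chain has `x(t) = Ξ` at the time `t`: the condition
is solved for the initial value of `y`. -/
def SolvesBoundary [Fintype c] (n g : ℕ) (a : ℝ) (z : ℕ → ℝ → c → ℂ) (R : ℝ → Matrix c d ℂ)
    (Ξ : Matrix (Fin n) d ℂ) : Prop :=
  ∀ᶠ t in pmInfty, botRows n g z 0 * R t =
    botInv n g t * (Complex.exp (-(Complex.I * a * t)) • Ξ -
      divPowMat (topPos n) (topPos n) t * (topRows n z 0 * R t) -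
      divPowMat (topPos n) (midPos n g) t * (midRows n g z 0 * R t))

lemma isBigO_cexp_neg_I (a : ℝ) (l : Filter ℝ) :
    (fun t : ℝ => Complex.exp (-(Complex.I * a * t))) =O[l] fun _ => (1 : ℝ) := by
  simpa using isBigO_cexp_I (-a) l

variable [Fintype c] {a : ℝ} {R : ℝ → Matrix c d ℂ} {Ξ : Matrix (Fin n) d ℂ}

lemma IsChain.topRows_boundary (h : IsChain (n + g + n) (Complex.I * a) z)
    (hR : SolvesBoundary n g a z R Ξ) : ∀ᶠ t in pmInfty, topRows n z t * R t = Ξ := by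
  filter_upwards [hR, eventually_pmInfty_ne_zero] with t hR ht
  rw [h.topRows_eq, Matrix.smul_mul, Matrix.add_mul, Matrix.add_mul, Matrix.mul_assoc _ _ (R t),
    Matrix.mul_assoc _ _ (R t), Matrix.mul_assoc _ _ (R t), hR, ← Matrix.mul_assoc _ (botInv n g t),
    divPowMat_mul_botInv ht, Matrix.one_mul]
  rw [show ∀ A B C : Matrix (Fin n) d ℂ, A + B + (C - A - B) = C by intros; abel, smul_smul,
    ← Complex.exp_add]
  simp

lemma IsChain.botRows_boundary (h : IsChain (n + g + n) (Complex.I * a) z)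
    (hR : SolvesBoundary n g a z R Ξ)
    (htop : MatBigO pmInfty (fun t => topRows n z 0 * R t) fun _ => (1 : ℝ))
    (hmid : MatBigO pmInfty (fun t => midRows n g z 0 * R t) fun _ => (1 : ℝ)) :
    MatBigO pmInfty (fun t => botRows n g z t * R t) fun t => t⁻¹ := by
  have h1 : MatBigO pmInfty (fun t => divPowMat (botPos n g) (botPos n g) t * botInv n g t)
      fun t => t⁻¹ := mul_botInv_bigO _ fun i => by simp only [botPos]; omega
  have h2 : MatBigO pmInfty (fun t => divPowMat (botPos n g) (botPos n g) t * botInv n g t *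
      divPowMat (topPos n) (topPos n) t) fun t => t⁻¹ :=
    mul_botInv_mul_bigO _ _ fun i j => by simp only [botPos, topPos]; omega
  have h3 : MatBigO pmInfty (fun t => divPowMat (botPos n g) (botPos n g) t * botInv n g t *
      divPowMat (topPos n) (midPos n g) t) fun t => t⁻¹ :=
    mul_botInv_mul_bigO _ _ fun i j => by simp only [botPos, midPos]; omega
  refine (MatBigO.bounded_smul (isBigO_cexp_I a _) (((h1.mul_bounded (MatBigO.bounded_smul
    (isBigO_cexp_neg_I a _) (MatBigO.const Ξ))).sub (h2.mul_bounded htop)).sub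
    (h3.mul_bounded hmid))).congr' ?_
  filter_upwards [hR] with t hR
  rw [h.botRows_eq, Matrix.smul_mul, Matrix.mul_assoc _ _ (R t), hR]
  simp only [Matrix.mul_sub, Matrix.mul_assoc]

lemma IsChain.midRows_boundary (h : IsChain (n + 1 + n) (Complex.I * a) z)
    (hR : SolvesBoundary n 1 a z R Ξ)
    (htop : MatBigO pmInfty (fun t => topRows n z 0 * R t) fun _ => (1 : ℝ)) :
    MatBigO pmInfty (fun t => midRows n 1 z t * R t -
      (Complex.exp (Complex.I * a * t) * (-1) ^ n) • (midRows n 1 z 0 * R t)) fun t => t⁻¹ := by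
  have h1 : MatBigO pmInfty (fun t => divPowMat (midPos n 1) (botPos n 1) t * botInv n 1 t)
      fun t => t⁻¹ := mul_botInv_bigO _ fun i => by simp only [midPos]; omega
  have h2 : MatBigO pmInfty (fun t => divPowMat (midPos n 1) (botPos n 1) t * botInv n 1 t *
      divPowMat (topPos n) (topPos n) t) fun t => t⁻¹ :=
    mul_botInv_mul_bigO _ _ fun i j => by simp only [midPos, topPos]; omega
  refine (MatBigO.bounded_smul (isBigO_cexp_I a _) ((h1.mul_bounded (MatBigO.bounded_smul
    (isBigO_cexp_neg_I a _) (MatBigO.const Ξ))).sub (h2.mul_bounded htop))).congr' ?_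
  filter_upwards [hR, eventually_pmInfty_ne_zero] with t hR ht
  have hmm : divPowMat (midPos n 1) (midPos n 1) t = 1 := by
    ext i j
    obtain rfl : i = j := Subsingleton.elim _ _
    have := divPow_natCast 0 t
    simpa [divPowMat] using this
  rw [h.midRows_eq, Matrix.smul_mul, Matrix.add_mul, hmm, Matrix.one_mul,
    Matrix.mul_assoc _ _ (R t), hR, mul_smul, ← smul_sub, Matrix.mul_sub, Matrix.mul_sub,
    Matrix.mul_sub, Matrix.mul_sub]
  have hc : divPowMat (midPos n 1) (botPos n 1) t * (botInv n 1 t *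
      (divPowMat (topPos n) (midPos n 1) t * (midRows n 1 z 0 * R t))) =
      (1 - (-1) ^ n : ℂ) • (midRows n 1 z 0 * R t) := by
    rw [← Matrix.mul_assoc, ← Matrix.mul_assoc, mid_botInv_mid ht, Matrix.smul_mul, Matrix.one_mul]
  rw [hc, sub_smul, one_smul]
  simp only [Matrix.mul_assoc]
  congr 1
  abel

end Chain

/-! ### Assembling chains from the blocks of a Hamiltonian flow -/

section Cons

variable {c : Type} {n m : ℕ} {ω : ℂ}

/-- The sequence that starts with the rows of `X` and goes on with `b`. -/
def consRows (X : ℝ → Matrix (Fin n) c ℂ) (b : ℕ → ℝ → c → ℂ) (k : ℕ) (t : ℝ) (j : c) : ℂ :=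
  if h : k < n then X t ⟨k, h⟩ j else b (k - n) t j

lemma consRows_add (X : ℝ → Matrix (Fin n) c ℂ) (b : ℕ → ℝ → c → ℂ) (k : ℕ) (t : ℝ) (j : c) :
    consRows X b (n + k) t j = b k t j := by
  simp [consRows]

@[simp]
lemma topRows_consRows (X : ℝ → Matrix (Fin n) c ℂ) (b : ℕ → ℝ → c → ℂ) :
    topRows n (consRows X b) = X := by
  ext t i j
  simp [topRows, consRows]

@[simp]
lemma midRows_consRows {g : ℕ} (X : ℝ → Matrix (Fin n) c ℂ) (b : ℕ → ℝ → c → ℂ) :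
    midRows n g (consRows X b) = topRows g b := by
  ext t i j
  simp [midRows, topRows, consRows_add]

@[simp]
lemma botRows_consRows {g : ℕ} (X : ℝ → Matrix (Fin n) c ℂ) (b : ℕ → ℝ → c → ℂ) :
    botRows n g (consRows X b) = midRows g n b := by
  ext t i j
  simp only [botRows, midRows, of_apply, Nat.add_assoc, consRows_add]

@[simp]
lemma midRows_zero (b : ℕ → ℝ → c → ℂ) : midRows 0 n b = topRows n b := by
  ext t i j
  simp [midRows, topRows]

lemma jordanN_mul_apply {c : Type} (n : ℕ) (ω : ℂ) (X : Matrix (Fin n) c ℂ) (i : Fin n) (j : c) :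
    (jordanN n ω * X) i j = ω * X i j + if h : (i : ℕ) + 1 < n then X ⟨i + 1, h⟩ j else 0 := by
  have h1 : ∀ k : Fin n, jordanN n ω i k * X k j =
      (if i = k then ω * X k j else 0) +
        if h : (i : ℕ) + 1 < n then (if (⟨i + 1, h⟩ : Fin n) = k then X k j else 0) else 0 := by
    intro k
    rcases eq_or_ne i k with rfl | hik
    · have : ¬ ((i : ℕ) + 1 = i) := by omega
      simp [jordanN, Fin.ext_iff]
    · have hik' := Fin.val_ne_of_ne hik
      by_cases hk : (i : ℕ) + 1 = k
      · have : (i : ℕ) + 1 < n := by omega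
        simp [jordanN, hik', hk, Fin.ext_iff]
      · simp [jordanN, hik', hk, Fin.ext_iff]
  rw [Matrix.mul_apply, Finset.sum_congr rfl fun k _ => h1 k, Finset.sum_add_distrib]
  by_cases h : (i : ℕ) + 1 < n <;> simp [h]

lemma isChain_zero (ω : ℂ) : IsChain 0 ω (fun _ _ _ => 0 : ℕ → ℝ → c → ℂ) :=
  ⟨fun _ _ _ _ => rfl, fun _ h => absurd h (Nat.not_lt_zero _)⟩

lemma IsChain.cons {b : ℕ → ℝ → c → ℂ} (hb : IsChain m ω b) {X : ℝ → Matrix (Fin n) c ℂ}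
    (hX : ∀ t i j, HasDerivAt (fun s => X s i j)
      ((jordanN n ω * X t + lastE n * of fun (_ : Unit) j => b 0 t j) i j) t) :
    IsChain (n + m) ω (consRows X b) := by
  refine ⟨fun k hk t j => ?_, fun k hk t j => ?_⟩
  · obtain ⟨k, rfl⟩ := Nat.exists_eq_add_of_le (le_trans (Nat.le_add_right n m) hk)
    rw [consRows_add]
    exact hb.zero k (by omega) t j
  · rcases lt_or_ge k n with h | h
    · have h1 : (fun s => consRows X b k s j) = fun s => X s ⟨k, h⟩ j := by
        ext s; simp [consRows, h]
      rw [h1]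
      refine (hX t ⟨k, h⟩ j).congr_deriv ?_
      rw [Matrix.add_apply, jordanN_mul_apply]
      by_cases h2 : k + 1 < n
      · simp [consRows, h, h2, Matrix.mul_apply, lastE, h2.ne]
      · obtain rfl : k + 1 = n := by omega
        simp [consRows, Matrix.mul_apply, lastE]
    · obtain ⟨k, rfl⟩ := Nat.exists_eq_add_of_le h
      simp only [Nat.add_assoc, consRows_add]
      exact hb.deriv k (by omega) t j

/-- A homogeneous chain is propagated by the exponential of a Jordan block. -/
lemma rows_eq_exp_mul {X : ℝ → Matrix (Fin n) c ℂ}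
    (hX : ∀ t i j, HasDerivAt (fun s => X s i j) ((jordanN n ω * X t) i j) t) (t : ℝ) :
    X t = Complex.exp (ω * t) • (divPowMat (topPos n) (topPos n) t * X 0) := by
  have h := (isChain_zero (c := c) ω).cons (X := X) fun t i j => by
    refine (hX t i j).congr_deriv ?_
    simp [Matrix.mul_apply]
  ext i j
  have h2 := chain_solution (z := fun k t => consRows X (fun _ _ _ => 0) k t j)
    (fun k hk t => h.zero k hk t j) (fun k hk t => h.deriv k hk t j)
    (show (i : ℕ) ≤ n + 0 by omega) t
  rw [Nat.add_zero, Finset.sum_range] at h2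
  simpa [consRows, Matrix.mul_apply, divPowMat, topPos] using h2

/-- Reversal of rows with alternating signs: it turns the block `-Nᴴ` of a Hamiltonian Jordan block
into an upper triangular Jordan block. -/
def flipMat (n : ℕ) (σ : ℂ) : Matrix (Fin n) (Fin n) ℂ :=
  of fun j k => if k = Fin.rev j then σ * (-1) ^ (j : ℕ) else 0

lemma flipMat_mul_apply (n : ℕ) (σ : ℂ) (Y : Matrix (Fin n) c ℂ) (i : Fin n) (j : c) :
    (flipMat n σ * Y) i j = σ * (-1) ^ (i : ℕ) * Y (Fin.rev i) j := by
  simp [flipMat, Matrix.mul_apply]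

lemma isUnit_flipMat (n : ℕ) {σ : ℂ} (hσ : σ ≠ 0) : IsUnit (flipMat n σ) := by
  refine IsUnit.of_mul_eq_one
    (of fun k j => if k = Fin.rev j then (σ * (-1) ^ (j : ℕ))⁻¹ else 0) ?_
  ext i j
  rw [flipMat_mul_apply]
  rcases eq_or_ne i j with rfl | h
  · simp only [of_apply, if_true, one_apply_eq]
    exact mul_inv_cancel₀ (mul_ne_zero hσ (pow_ne_zero _ (by norm_num)))
  · simp [h]

lemma flipMat_mul_neg_jordanN (n : ℕ) (σ ω : ℂ) :
    flipMat n σ * -(jordanN n ω)ᴴ = jordanN n (-star ω) * flipMat n σ := by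
  ext i j
  rw [flipMat_mul_apply, jordanN_mul_apply]
  simp only [jordanN, flipMat, of_apply]
  by_cases h1 : j = Fin.rev i
  · subst h1
    by_cases h : (i : ℕ) + 1 < n
    · have : ¬ (Fin.rev i = Fin.rev (⟨i + 1, h⟩ : Fin n)) := by
        simp only [Fin.ext_iff, Fin.val_rev]; omega
      simp [h, this]; ring
    · simp [h]; ring
  · have h1' : ¬ ((j : ℕ) = n - (i + 1)) := by simpa [Fin.ext_iff, Fin.val_rev] using h1
    by_cases h : (i : ℕ) + 1 < n
    · by_cases h2 : j = Fin.rev (⟨i + 1, h⟩ : Fin n)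
      · have h3 : (j : ℕ) = n - (i + 1 + 1) := by simpa [Fin.ext_iff, Fin.val_rev] using h2
        have h4 : (j : ℕ) + 1 = n - (i + 1) := by omega
        simp [h, h2, Fin.ext_iff, Fin.val_rev, pow_succ]
        have h5 : n - (i + 1 + 1) + 1 = n - ((i : ℕ) + 1) := by omega
        have h6 : ¬ (n - (i + 1 + 1) = n - ((i : ℕ) + 1)) := by omega
        simp [h5, h6]
      · have h3 : ¬ ((j : ℕ) = n - (i + 1 + 1)) := by simpa [Fin.ext_iff, Fin.val_rev] using h2
        have h4 : ¬ ((j : ℕ) + 1 = n - (i + 1)) := by omega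
        simp [h, h1, h2, h1', h4, Fin.ext_iff, Fin.val_rev]
    · have h4 : ¬ ((j : ℕ) + 1 = n - (i + 1)) := by omega
      simp [h, h1, h1', h4, Fin.ext_iff, Fin.val_rev]

lemma hasDerivAt_mul_left {m k : Type} [Fintype m] (A : Matrix k m ℂ) {Y : ℝ → Matrix m c ℂ}
    {Y' : Matrix m c ℂ} {t : ℝ}
    (hY : ∀ i j, HasDerivAt (fun s => Y s i j) (Y' i j) t) (i : k) (j : c) :
    HasDerivAt (fun s => (A * Y s) i j) ((A * Y') i j) t := by
  simp only [Matrix.mul_apply]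
  exact HasDerivAt.fun_sum fun x _ => (hY x j).const_mul _

lemma hasDerivAt_flipMat (σ : ℂ) {Y : ℝ → Matrix (Fin n) c ℂ} {t : ℝ}
    (hY : ∀ i j, HasDerivAt (fun s => Y s i j) ((-(jordanN n ω)ᴴ * Y t) i j) t)
    (i : Fin n) (j : c) : HasDerivAt (fun s => (flipMat n σ * Y s) i j)
      ((jordanN n (-star ω) * (flipMat n σ * Y t)) i j) t := by
  rw [← Matrix.mul_assoc, ← flipMat_mul_neg_jordanN, Matrix.mul_assoc]
  exact hasDerivAt_mul_left _ hY i j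

/-- The first row of the reversed block is the multiple `σ e_nᴴ Y` of its last row. -/
lemma consRows_flipMat_zero (σ : ℂ) (Y : ℝ → Matrix (Fin n) c ℂ) (t : ℝ) (j : c) :
    consRows (fun s => flipMat n σ * Y s) (fun _ _ _ => 0) 0 t j =
      σ * ((lastE n)ᴴ * Y t) () j := by
  rcases n with _ | n
  · simp [consRows, Matrix.mul_apply]
  have h1 : ((lastE (n + 1))ᴴ * Y t) () j = Y t (Fin.last n) j := by
    rw [Matrix.mul_apply, Finset.sum_eq_single (Fin.last n)]
    · simp [lastE]
    · intro b _ hb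
      have : (b : ℕ) ≠ n := fun h => hb (Fin.ext h)
      simp [lastE, this]
    · simp
  have h2 := flipMat_mul_apply (n + 1) σ (Y t) 0 j
  simp only [Fin.val_zero, pow_zero, mul_one, Fin.rev_zero] at h2
  rw [h1, ← h2]
  simp [consRows]

lemma lastE_mul_flipMat (σ : ℂ) (Y : ℝ → Matrix (Fin n) c ℂ) (t : ℝ) :
    lastE n * of (fun (_ : Unit) j => consRows (fun s => flipMat n σ * Y s) (fun _ _ _ => 0) 0 t j)
      = σ • (lastE n * ((lastE n)ᴴ * Y t)) := by
  rw [← Matrix.mul_smul]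
  congr 1
  ext i j
  exact consRows_flipMat_zero σ Y t j

end Cons

/-! ### The flow in canonical coordinates -/

section Flow

variable {ι : Type} [Fintype ι] [DecidableEq ι]

lemma symJ_mul_symJ : symJ ι * symJ ι = -1 := by
  rw [symJ, fromBlocks_multiply, ← fromBlocks_one, fromBlocks_neg]
  simp

lemma IsSymplectic.mul_inverse {S : Matrix (ι ⊕ ι) (ι ⊕ ι) ℂ} (hS : IsSymplectic S) :
    S * -(symJ ι * Sᴴ * symJ ι) = 1 := by
  rw [Matrix.mul_neg, ← Matrix.mul_assoc, ← Matrix.mul_assoc, hS, symJ_mul_symJ, neg_neg]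

lemma IsSymplectic.isUnit {S : Matrix (ι ⊕ ι) (ι ⊕ ι) ℂ} (hS : IsSymplectic S) : IsUnit S :=
  IsUnit.of_mul_eq_one _ hS.mul_inverse

lemma IsSymplectic.mul_inv {S : Matrix (ι ⊕ ι) (ι ⊕ ι) ℂ} (hS : IsSymplectic S) : S * S⁻¹ = 1 :=
  Matrix.mul_nonsing_inv _ ((Matrix.isUnit_iff_isUnit_det _).1 hS.isUnit)

lemma IsSymplectic.inv_mul {S : Matrix (ι ⊕ ι) (ι ⊕ ι) ℂ} (hS : IsSymplectic S) : S⁻¹ * S = 1 :=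
  Matrix.nonsing_inv_mul _ ((Matrix.isUnit_iff_isUnit_det _).1 hS.isUnit)

lemma IsSymplectic.conjTranspose_mul {S : Matrix (ι ⊕ ι) (ι ⊕ ι) ℂ} (hS : IsSymplectic S) :
    Sᴴ * symJ ι * S = symJ ι := by
  have h := mul_eq_one_comm.1 hS.mul_inverse
  calc Sᴴ * symJ ι * S = -(symJ ι * symJ ι) * (Sᴴ * symJ ι * S) := by rw [symJ_mul_symJ]; simp
    _ = symJ ι * (-(symJ ι * Sᴴ * symJ ι) * S) := by
      simp only [Matrix.neg_mul, Matrix.mul_neg, Matrix.mul_assoc]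
    _ = symJ ι := by rw [h, Matrix.mul_one]

variable {J H S : Matrix (ι ⊕ ι) (ι ⊕ ι) ℂ} {W₀ : Matrix ι ι ℂ} {Y : ℝ → Matrix (ι ⊕ ι) ι ℂ}

/-- The upper half of `S⁻¹ Y`. -/
def coordX (S : Matrix (ι ⊕ ι) (ι ⊕ ι) ℂ) (Y : ℝ → Matrix (ι ⊕ ι) ι ℂ) (t : ℝ) : Matrix ι ι ℂ :=
  (S⁻¹ * Y t).toRows₁

/-- The lower half of `S⁻¹ Y`. -/
def coordY (S : Matrix (ι ⊕ ι) (ι ⊕ ι) ℂ) (Y : ℝ → Matrix (ι ⊕ ι) ι ℂ) (t : ℝ) : Matrix ι ι ℂ :=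
  (S⁻¹ * Y t).toRows₂

lemma IsFlow.coordX_zero (h : IsFlow J H S W₀ Y) : coordX S Y 0 = coordW₁ S W₀ := by
  rw [coordX, h.initial]
  rfl

lemma IsFlow.coordY_zero (h : IsFlow J H S W₀ Y) : coordY S Y 0 = coordW₂ S W₀ := by
  rw [coordY, h.initial]
  rfl

lemma IsFlow.eq_mul (h : IsFlow J H S W₀ Y) (t : ℝ) :
    Y t = fromRows (S.toBlocks₁₁ * coordX S Y t + S.toBlocks₁₂ * coordY S Y t)
      (S.toBlocks₂₁ * coordX S Y t + S.toBlocks₂₂ * coordY S Y t) := by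
  have h1 : S * (S⁻¹ * Y t) = Y t := by
    rw [← Matrix.mul_assoc, h.symplectic.mul_inv, Matrix.one_mul]
  conv_lhs => rw [← h1, ← fromBlocks_toBlocks S, ← fromRows_toRows (_ * Y t),
    fromBlocks_mul_fromRows]
  rw [fromBlocks_toBlocks S]
  rfl

lemma IsFlow.flowQ_eq (h : IsFlow J H S W₀ Y) (t : ℝ) :
    flowQ Y t = S.toBlocks₁₁ * coordX S Y t + S.toBlocks₁₂ * coordY S Y t := by
  rw [flowQ, h.eq_mul t, toRows₁_fromRows]

lemma IsFlow.flowP_eq (h : IsFlow J H S W₀ Y) (t : ℝ) :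
    flowP Y t = S.toBlocks₂₁ * coordX S Y t + S.toBlocks₂₂ * coordY S Y t := by
  rw [flowP, h.eq_mul t, toRows₂_fromRows]

lemma IsFlow.hasDerivAt {R D G : Matrix ι ι ℂ} (h : IsFlow (hamBlocks R D G) H S W₀ Y) (t : ℝ)
    (i : ι ⊕ ι) (j : ι) : HasDerivAt (fun s => (S⁻¹ * Y s) i j)
      ((fromRows (R * coordX S Y t + D * coordY S Y t)
        (G * coordX S Y t + -Rᴴ * coordY S Y t)) i j) t := by
  refine (hasDerivAt_mul_left S⁻¹ (h.ode t) i j).congr_deriv ?_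
  have h1 : S⁻¹ * (H * Y t) = hamBlocks R D G * (S⁻¹ * Y t) := by
    rw [← h.canonical, Matrix.mul_assoc, Matrix.mul_assoc, ← Matrix.mul_assoc S,
      h.symplectic.mul_inv, Matrix.one_mul]
  rw [h1, ← fromRows_toRows (S⁻¹ * Y t), hamBlocks, fromBlocks_mul_fromRows]
  rfl

lemma IsFlow.hasDerivAt_coordX {R D G : Matrix ι ι ℂ} (h : IsFlow (hamBlocks R D G) H S W₀ Y)
    (t : ℝ) (i j : ι) : HasDerivAt (fun s => coordX S Y s i j)
      ((R * coordX S Y t + D * coordY S Y t) i j) t :=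
  h.hasDerivAt t (Sum.inl i) j

lemma IsFlow.hasDerivAt_coordY {R D G : Matrix ι ι ℂ} (h : IsFlow (hamBlocks R D G) H S W₀ Y)
    (t : ℝ) (i j : ι) : HasDerivAt (fun s => coordY S Y s i j)
      ((G * coordX S Y t + -Rᴴ * coordY S Y t) i j) t :=
  h.hasDerivAt t (Sum.inr i) j

end Flow

/-- If the combination `R` of solutions makes the coordinates `A` equal to the identity and the
complementary coordinates `B` small, then the Riccati solution tends to the quotient of the blocks
that belong to `A`. -/
lemma dominant_block_asymptotics {ι : Type} [Fintype ι] [DecidableEq ι] {l : Filter ℝ}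
    {Q P A B R : ℝ → Matrix ι ι ℂ} {M₁ M₂ N₁ N₂ : Matrix ι ι ℂ} {g h : ℝ → ℝ}
    (hQ : ∀ t, Q t = M₁ * A t + N₁ * B t) (hP : ∀ t, P t = M₂ * A t + N₂ * B t)
    (hA : ∀ᶠ t in l, A t * R t = 1) (hB : MatBigO l (fun t => B t * R t) h)
    (hR : MatBigO l R g) (hh : Tendsto h l (nhds 0)) (hM : IsUnit M₁) :
    (∀ᶠ t in l, IsUnit (Q t)) ∧ MatBigO l (fun t => P t * (Q t)⁻¹ - M₂ * M₁⁻¹) h ∧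
      MatBigO l (fun t => (Q t)⁻¹) g := by
  have key : ∀ (M N : Matrix ι ι ℂ) (F : ℝ → Matrix ι ι ℂ), (∀ t, F t = M * A t + N * B t) →
      MatBigO l (fun t => F t * R t - M) h := by
    intro M N F hF
    refine (hB.const_mul N).congr' ?_
    filter_upwards [hA] with t ht
    rw [hF, Matrix.add_mul, Matrix.mul_assoc, ht, Matrix.mul_assoc, Matrix.mul_one,
      add_sub_cancel_left]
  obtain ⟨h1, h2, h3, h4⟩ := quotient_asymptotics hh (key _ _ _ hQ) (key _ _ _ hP)
    (hA.mono fun t ht => IsUnit.of_mul_eq_one_right _ ht) hM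
  exact ⟨h1, h2, (hR.mul_bounded (h4.bounded_of_sub (hh.isBigO_one ℝ))).congr'
    (h3.mono fun t ht => ht.symm)⟩

/-- The solution `T` of `T = L - K T` for a small matrix function `K`. -/
lemma fixedPoint_asymptotics {ι : Type} [Fintype ι] [DecidableEq ι]
    {K L : ℝ → Matrix ι ι ℂ} (hK : MatBigO pmInfty K fun t => t⁻¹) {g : ℝ → ℝ}
    (hL : MatBigO pmInfty L g) (hLu : ∀ᶠ t in pmInfty, IsUnit (L t)) :
    ∃ T : ℝ → Matrix ι ι ℂ, (∀ᶠ t in pmInfty, T t = L t - K t * T t) ∧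
      MatBigO pmInfty T g ∧ ∀ᶠ t in pmInfty, IsUnit (T t) := by
  obtain ⟨h1, h2⟩ := MatBigO.inv_sub (M := fun t => 1 + K t) (M₀ := 1)
    (hK.congr' (Eventually.of_forall fun t => by simp)) tendsto_inv_pmInfty isUnit_one
  refine ⟨fun t => (1 + K t)⁻¹ * L t, ?_, (h2.bounded_of_sub isBigO_inv_pmInfty).bounded_mul hL, ?_⟩
  · filter_upwards [h1] with t ht
    have := Matrix.mul_nonsing_inv_cancel_left _ (L t) ((Matrix.isUnit_iff_isUnit_det _).1 ht)
    rw [Matrix.add_mul, Matrix.one_mul] at this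
    rw [eq_sub_iff_add_eq, this]
  · filter_upwards [h1, hLu] with t ht hL
    exact ((Matrix.isUnit_nonsing_inv_iff).2 ht).mul hL

/-! ### Types `r` and `e` -/

lemma divPowMat_mul_neg (n : ℕ) (t : ℝ) :
    divPowMat (topPos n) (topPos n) t * divPowMat (topPos n) (topPos n) (-t) = 1 := by
  have h := rows_eq_exp_mul (ω := 0) (X := fun s => divPowMat (topPos n) (topPos n) (s - t))
    (fun s i j => by
      refine ((hasDerivAt_divPow _ _).comp_sub_const s t).congr_deriv ?_
      rw [jordanN_mul_apply]
      by_cases hi : (i : ℕ) + 1 < n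
      · simp [hi, divPowMat, topPos, sub_add_eq_sub_sub]
      · simp only [hi, zero_mul, zero_add, dite_false]
        exact divPow_of_neg (by simp only [topPos]; omega) _) t
  simp only [sub_self, zero_mul, Complex.exp_zero, one_smul, zero_sub] at h
  rw [← h]
  ext i j
  rcases eq_or_ne i j with rfl | hij
  · simp [divPowMat, divPow_zero_right]
  · have : ¬ ((j : ℕ) : ℤ) - (i : ℕ) = 0 := by have := Fin.val_ne_of_ne hij; omega
    simp [divPowMat, divPow_zero_right, hij, topPos, this]

lemma divPowMat_bigO {n : ℕ} {l : Filter ℝ} (hl : ∀ᶠ t in l, 1 ≤ |t|) {u : ℝ → ℝ}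
    (hu : ∀ t, |u t| = |t|) :
    MatBigO l (fun t => divPowMat (topPos n) (topPos n) (u t)) fun t => |t| ^ (n - 1) := by
  intro i j
  refine IsBigO.of_bound ‖divPow (topPos n j - topPos n i) 1‖ ?_
  filter_upwards [hl] with t ht
  simp only [divPowMat, of_apply]
  rw [divPow_eq_zpow_mul, norm_mul, mul_comm, norm_zpow, Complex.norm_real, Real.norm_eq_abs, hu,
    norm_pow, Real.norm_eq_abs, abs_abs, ← zpow_natCast]
  refine mul_le_mul_of_nonneg_left (zpow_le_zpow_right₀ ht ?_) (norm_nonneg _)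
  simp only [topPos]
  omega

lemma isBigO_cexp_of_re {l : Filter ℝ} {f : ℝ → ℂ} {a : ℝ} (h : ∀ᶠ t in l, (f t).re = -a * |t|) :
    (fun t => Complex.exp (f t)) =O[l] fun t => Real.exp (-a * |t|) := by
  refine IsBigO.of_bound 1 ?_
  filter_upwards [h] with t ht
  rw [Complex.norm_exp, ht, one_mul, Real.norm_eq_abs, Real.abs_exp]

lemma tendsto_exp_mul_pow {l : Filter ℝ} (hl : Tendsto (fun t : ℝ => |t|) l atTop) {a : ℝ}
    (ha : 0 < a) (k : ℕ) : Tendsto (fun t => Real.exp (-a * |t|) * |t| ^ k) l (nhds 0) := by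
  have h := (tendsto_rpow_mul_exp_neg_mul_atTop_nhds_zero k a ha).comp hl
  refine h.congr fun t => ?_
  simp [mul_comm]

/-- Both halves of type `r`: the dominant coordinates `A` grow like `exp (b₁ t)`, the
complementary coordinates `B` decay at the same rate, along a filter on which `-Re b₁ t` and
`Re b₂ t` equal `-a |t|`. The constant matrices `F₁`, `F₂` bring the two chains to upper triangular
form. -/
lemma hyperbolic_asymptotics {n : ℕ} {l : Filter ℝ} (hl : Tendsto (fun t : ℝ => |t|) l atTop)
    {a : ℝ} (ha : 0 < a) {b₁ b₂ : ℂ} (hb₁ : ∀ᶠ t : ℝ in l, (-(b₁ * t)).re = -a * |t|)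
    (hb₂ : ∀ᶠ t : ℝ in l, (b₂ * t).re = -a * |t|)
    {Q P A B : ℝ → Matrix (Fin n) (Fin n) ℂ} {M₁ M₂ N₁ N₂ F₁ F₂ : Matrix (Fin n) (Fin n) ℂ}
    (hQ : ∀ t, Q t = M₁ * A t + N₁ * B t) (hP : ∀ t, P t = M₂ * A t + N₂ * B t)
    (hA : ∀ t, F₁ * A t = Complex.exp (b₁ * t) •
      (divPowMat (topPos n) (topPos n) t * (F₁ * A 0)))
    (hB : ∀ t, F₂ * B t = Complex.exp (b₂ * t) •
      (divPowMat (topPos n) (topPos n) t * (F₂ * B 0)))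
    (hF₁ : IsUnit F₁) (hF₂ : IsUnit F₂) (hA₀ : IsUnit (A 0)) (hM : IsUnit M₁) :
    (∀ᶠ t in l, IsUnit (Q t)) ∧
      MatBigO l (fun t => P t * (Q t)⁻¹ - M₂ * M₁⁻¹)
        (fun t => Real.exp (-2 * a * |t|) * |t| ^ (2 * (n - 1))) ∧
      MatBigO l (fun t => (Q t)⁻¹) (fun t => Real.exp (-a * |t|) * |t| ^ (n - 1)) := by
  set E : ℝ → Matrix (Fin n) (Fin n) ℂ := divPowMat (topPos n) (topPos n)
  have hl1 : ∀ᶠ t in l, 1 ≤ |t| := hl.eventually_ge_atTop 1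
  set R : ℝ → Matrix (Fin n) (Fin n) ℂ := fun t =>
    (A 0)⁻¹ * F₁⁻¹ * (Complex.exp (-(b₁ * t)) • E (-t)) * F₁ with hRdef
  have hdF₁ := (Matrix.isUnit_iff_isUnit_det _).1 hF₁
  have hR : MatBigO l R fun t => Real.exp (-a * |t|) * |t| ^ (n - 1) :=
    ((MatBigO.smul (isBigO_cexp_of_re hb₁) (divPowMat_bigO hl1 abs_neg)).const_mul _).mul_const _
  have hBO : MatBigO l B fun t => Real.exp (-a * |t|) * |t| ^ (n - 1) := by
    refine ((MatBigO.smul (isBigO_cexp_of_re hb₂) ((divPowMat_bigO (u := id) hl1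
      fun _ => rfl).mul_const (F₂ * B 0))).const_mul F₂⁻¹).congr' (Eventually.of_forall fun t => ?_)
    rw [id, ← hB, Matrix.nonsing_inv_mul_cancel_left _ _ ((Matrix.isUnit_iff_isUnit_det _).1 hF₂)]
  have hAR : ∀ t, A t * R t = 1 := by
    intro t
    have h1 : F₁ * (A t * R t) = F₁ := by
      rw [← Matrix.mul_assoc, hA, hRdef]
      simp only [Matrix.smul_mul, Matrix.mul_smul, smul_smul, ← Complex.exp_add]
      rw [neg_add_cancel, Complex.exp_zero, one_smul]
      calc E t * (F₁ * A 0) * ((A 0)⁻¹ * F₁⁻¹ * E (-t) * F₁)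
          = E t * (F₁ * (A 0 * (A 0)⁻¹) * F₁⁻¹) * E (-t) * F₁ := by simp only [Matrix.mul_assoc]
        _ = F₁ := by
          rw [Matrix.mul_nonsing_inv _ ((Matrix.isUnit_iff_isUnit_det _).1 hA₀), Matrix.mul_one,
            Matrix.mul_nonsing_inv _ hdF₁, Matrix.mul_one, divPowMat_mul_neg, Matrix.one_mul]
    calc A t * R t = F₁⁻¹ * (F₁ * (A t * R t)) :=
          (Matrix.nonsing_inv_mul_cancel_left _ _ hdF₁).symm
      _ = 1 := by rw [h1, Matrix.nonsing_inv_mul _ hdF₁]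
  have hrate : ∀ t : ℝ, Real.exp (-a * |t|) * |t| ^ (n - 1) * (Real.exp (-a * |t|) * |t| ^ (n - 1))
      = Real.exp (-2 * a * |t|) * |t| ^ (2 * (n - 1)) := by
    intro t
    rw [show -2 * a * |t| = -a * |t| + -a * |t| by ring, Real.exp_add, two_mul, pow_add]
    ring
  have hlim : Tendsto (fun t => Real.exp (-2 * a * |t|) * |t| ^ (2 * (n - 1))) l (nhds 0) := by
    have := tendsto_exp_mul_pow hl (mul_pos two_pos ha) (2 * (n - 1))
    simpa only [neg_mul] using this
  exact dominant_block_asymptotics hQ hP (Eventually.of_forall hAR)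
    (by simpa only [hrate] using hBO.mul hR) hR hlim hM

lemma riccati_typeR {n : ℕ} {lam : ℂ} (hlam : 0 < lam.re)
    {H S : Matrix (Fin n ⊕ Fin n) (Fin n ⊕ Fin n) ℂ} {W₀ : Matrix (Fin n) (Fin n) ℂ}
    {Y : ℝ → Matrix (Fin n ⊕ Fin n) (Fin n) ℂ} (h : IsFlow (blockR n lam) H S W₀ Y) :
    (IsUnit S.toBlocks₁₁ → IsUnit (coordW₁ S W₀) →
        (∀ᶠ t in atTop, IsUnit (flowQ Y t)) ∧
        MatBigO atTop (fun t => flowW Y t - S.toBlocks₂₁ * S.toBlocks₁₁⁻¹)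
          (fun t => Real.exp (-2 * lam.re * t) * t ^ (2 * (n - 1))) ∧
        MatBigO atTop (fun t => (flowQ Y t)⁻¹)
          (fun t => Real.exp (-lam.re * t) * t ^ (n - 1))) ∧
      (IsUnit S.toBlocks₁₂ → IsUnit (coordW₂ S W₀) →
        (∀ᶠ t in atBot, IsUnit (flowQ Y t)) ∧
        MatBigO atBot (fun t => flowW Y t - S.toBlocks₂₂ * S.toBlocks₁₂⁻¹)
          (fun t => Real.exp (-2 * lam.re * |t|) * |t| ^ (2 * (n - 1))) ∧
        MatBigO atBot (fun t => (flowQ Y t)⁻¹)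
          (fun t => Real.exp (-lam.re * |t|) * |t| ^ (n - 1))) := by
  have hX : ∀ t, 1 * coordX S Y t = Complex.exp (lam * t) •
      (divPowMat (topPos n) (topPos n) t * (1 * coordX S Y 0)) := by
    intro t
    simp only [Matrix.one_mul]
    refine rows_eq_exp_mul (fun t i j => ?_) t
    simpa using h.hasDerivAt_coordX t i j
  have hY : ∀ t, flipMat n 1 * coordY S Y t = Complex.exp (-star lam * t) •
      (divPowMat (topPos n) (topPos n) t * (flipMat n 1 * coordY S Y 0)) := by
    refine rows_eq_exp_mul (X := fun t => flipMat n 1 * coordY S Y t) (fun t i j => ?_)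
    refine hasDerivAt_flipMat 1 (fun i j => ?_) i j
    simpa using h.hasDerivAt_coordY t i j
  have hF := isUnit_flipMat n one_ne_zero
  constructor
  · intro hU hW
    rw [← h.coordX_zero] at hW
    obtain ⟨h1, h2, h3⟩ := hyperbolic_asymptotics tendsto_abs_atTop_atTop hlam
      (by filter_upwards [eventually_ge_atTop 0] with t ht; simp [abs_of_nonneg ht])
      (by filter_upwards [eventually_ge_atTop 0] with t ht; simp [abs_of_nonneg ht])
      h.flowQ_eq h.flowP_eq hX hY isUnit_one hF hW hU
    have habs : ∀ᶠ t : ℝ in atTop, |t| = t := by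
      filter_upwards [eventually_ge_atTop 0] with t ht using abs_of_nonneg ht
    refine ⟨h1, h2.trans (EventuallyEq.isBigO ?_), h3.trans (EventuallyEq.isBigO ?_)⟩
    · filter_upwards [habs] with t ht
      rw [ht]
    · filter_upwards [habs] with t ht
      rw [ht]
  · intro hV hW
    rw [← h.coordY_zero] at hW
    exact hyperbolic_asymptotics tendsto_abs_atBot_atTop hlam
      (by filter_upwards [eventually_le_atBot 0] with t ht; simp [abs_of_nonpos ht])
      (by filter_upwards [eventually_le_atBot 0] with t ht; simp [abs_of_nonpos ht])
      (fun t => (h.flowQ_eq t).trans (add_comm _ _)) (fun t => (h.flowP_eq t).trans (add_comm _ _))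
      hY hX hF isUnit_one hW hV

lemma riccati_typeE {n : ℕ} {α : ℝ} {β : ℂ} (hβ : β = -1 ∨ β = 1)
    {H S : Matrix (Fin n ⊕ Fin n) (Fin n ⊕ Fin n) ℂ} {W₀ : Matrix (Fin n) (Fin n) ℂ}
    {Y : ℝ → Matrix (Fin n ⊕ Fin n) (Fin n) ℂ} (h : IsFlow (blockE n α β) H S W₀ Y)
    (hU : IsUnit S.toBlocks₁₁) (hW : IsUnit (coordW₂ S W₀)) :
    (∀ᶠ t in pmInfty, IsUnit (flowQ Y t)) ∧
      MatBigO pmInfty (fun t => flowW Y t - S.toBlocks₂₁ * S.toBlocks₁₁⁻¹) (fun t => t⁻¹) ∧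
      MatBigO pmInfty (fun t => (flowQ Y t)⁻¹) (fun t => t⁻¹) := by
  have hβ0 : β ≠ 0 := by rcases hβ with rfl | rfl <;> norm_num
  have hF := isUnit_flipMat n hβ0
  have hdF := (Matrix.isUnit_iff_isUnit_det _).1 hF
  have hdW := (Matrix.isUnit_iff_isUnit_det _).1 hW
  have hω : -star (Complex.I * α) = Complex.I * α := by simp
  -- `coordX` followed by the reversed `coordY` is a chain of length `2 n`
  set b := consRows (fun t => flipMat n β * coordY S Y t) (fun _ _ _ => 0) with hb
  have hbot : IsChain (n + 0) (Complex.I * α) b := (isChain_zero _).cons fun t i j => by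
    have := hasDerivAt_flipMat (n := n) (ω := Complex.I * α) β (Y := coordY S Y) (t := t)
      (fun i j => by simpa using h.hasDerivAt_coordY t i j) i j
    rw [hω] at this
    simpa [Matrix.mul_apply] using this
  have hz : IsChain (n + 0 + n) (Complex.I * α) (consRows (coordX S Y) b) := by
    have := IsChain.cons (n := n) hbot (X := coordX S Y) fun t i j => ?_
    · rwa [show n + (n + 0) = n + 0 + n by omega] at this
    rw [hb, lastE_mul_flipMat, ← Matrix.mul_assoc, ← Matrix.smul_mul]
    exact h.hasDerivAt_coordX t i j
  obtain ⟨T, hfix, hTO, hTu⟩ := fixedPoint_asymptotics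
    (((botInv_mul_bigO (n := n) (g := 0) (topPos n) fun i => by
      simp only [topPos]; omega).const_mul (flipMat n β)⁻¹).mul_const
      (coordW₁ S W₀ * (coordW₂ S W₀)⁻¹))
    (MatBigO.bounded_smul (isBigO_cexp_neg_I α pmInfty)
      ((botInv_bigO (n := n) (g := 0)).const_mul (flipMat n β)⁻¹))
    (by
      filter_upwards [eventually_pmInfty_ne_zero] with t ht
      exact IsUnit.smul (Units.mk0 _ (Complex.exp_ne_zero _))
        (((Matrix.isUnit_nonsing_inv_iff).2 hF).mul (isUnit_botInv ht)))
  set R : ℝ → Matrix (Fin n) (Fin n) ℂ := fun t => (coordW₂ S W₀)⁻¹ * T t with hR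
  have hRO : MatBigO pmInfty R fun t => t⁻¹ := hTO.const_mul _
  have hRO1 : MatBigO pmInfty R fun _ => (1 : ℝ) := hRO.trans isBigO_inv_pmInfty
  have hsolve : SolvesBoundary n 0 α (consRows (coordX S Y) b) R 1 := by
    filter_upwards [hfix] with t ht
    simp only [topRows_consRows, botRows_consRows, midRows_zero, hb, hR]
    rw [h.coordX_zero, h.coordY_zero, Matrix.mul_assoc,
      Matrix.mul_nonsing_inv_cancel_left _ _ hdW]
    have hmid : ∀ (A : Matrix (Fin n) (Fin 0) ℂ) (B : Matrix (Fin 0) (Fin n) ℂ), A * B = 0 := by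
      intro A B; ext; simp [Matrix.mul_apply]
    conv_lhs => rw [ht]
    rw [hmid, sub_zero, Matrix.mul_sub, Matrix.mul_sub, Matrix.mul_smul, Matrix.mul_smul,
      Matrix.mul_nonsing_inv_cancel_left _ _ hdF, Matrix.mul_one]
    simp only [Matrix.mul_assoc]
    rw [Matrix.mul_nonsing_inv_cancel_left _ _ hdF]
  have htop := hz.topRows_boundary hsolve
  have hbotO := hz.botRows_boundary hsolve (hRO1.const_mul _) (hRO1.const_mul _)
  simp only [topRows_consRows, botRows_consRows, midRows_zero, hb] at htop hbotO
  refine dominant_block_asymptotics h.flowQ_eq h.flowP_eq htop ?_ hRO tendsto_inv_pmInfty hU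
  refine (hbotO.const_mul (flipMat n β)⁻¹).congr' (Eventually.of_forall fun t => ?_)
  rw [Matrix.mul_assoc, Matrix.nonsing_inv_mul_cancel_left _ _ hdF]

/-! ### Types `c` and `d`: decoupling into two chains of odd length -/

lemma neg_star_I_mul (a : ℝ) : -star (Complex.I * (a : ℂ)) = Complex.I * a := by simp

lemma halfSqrtTwo_mul_self : halfSqrtTwo * halfSqrtTwo = 1 / 2 := by
  rw [halfSqrtTwo, ← Complex.ofReal_mul]
  have : Real.sqrt 2 / 2 * (Real.sqrt 2 / 2) = 1 / 2 := by
    have := Real.mul_self_sqrt (show (0 : ℝ) ≤ 2 by norm_num)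
    linarith
  rw [this]
  norm_num

lemma star_halfSqrtTwo : (starRingEnd ℂ) halfSqrtTwo = halfSqrtTwo := Complex.conj_ofReal _

section OddChain

variable {c : Type} {n : ℕ} {a : ℝ} {σ : ℂ}

/-- The chain of length `2 n + 1` formed by `x`, `p` and the reversal of `y`. -/
def oddChain (σ : ℂ) (x : ℝ → Matrix (Fin n) c ℂ) (p : ℝ → Matrix (Fin 1) c ℂ)
    (y : ℝ → Matrix (Fin n) c ℂ) : ℕ → ℝ → c → ℂ :=
  consRows x (consRows p (consRows (fun t => flipMat n σ * y t) fun _ _ _ => 0))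

variable {x : ℝ → Matrix (Fin n) c ℂ} {p : ℝ → Matrix (Fin 1) c ℂ} {y : ℝ → Matrix (Fin n) c ℂ}

lemma topRows_oddChain : topRows n (oddChain σ x p y) = x := by simp [oddChain]

lemma midRows_oddChain : midRows n 1 (oddChain σ x p y) = p := by simp [oddChain]

lemma botRows_oddChain : botRows n 1 (oddChain σ x p y) = fun t => flipMat n σ * y t := by
  simp [oddChain]

lemma isChain_oddChain
    (hx : ∀ t i j, HasDerivAt (fun s => x s i j)
      ((jordanN n (Complex.I * a) * x t) i j + lastE n i () * p t 0 j) t)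
    (hp : ∀ t j, HasDerivAt (fun s => p s 0 j)
      (Complex.I * a * p t 0 j + σ * ((lastE n)ᴴ * y t) () j) t)
    (hy : ∀ t i j, HasDerivAt (fun s => y s i j) ((-(jordanN n (Complex.I * a))ᴴ * y t) i j) t) :
    IsChain (n + 1 + n) (Complex.I * a) (oddChain σ x p y) := by
  have h1 : IsChain (n + 0) (Complex.I * a)
      (consRows (fun t => flipMat n σ * y t) fun _ _ _ => 0) :=
    (isChain_zero _).cons fun t i j => by
      have := hasDerivAt_flipMat (n := n) (ω := Complex.I * a) σ (hy t) i j
      rw [neg_star_I_mul] at this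
      simpa [Matrix.mul_apply] using this
  have h2 := h1.cons (X := p) fun t i j => by
    obtain rfl : i = 0 := Subsingleton.elim _ _
    refine (hp t j).congr_deriv ?_
    rw [Matrix.add_apply, jordanN_mul_apply, ← consRows_flipMat_zero]
    simp [Matrix.mul_apply, lastE]
  have h3 := h2.cons (X := x) fun t i j => by
    refine (hx t i j).congr_deriv ?_
    rw [Matrix.add_apply]
    simp [Matrix.mul_apply, consRows]
  rwa [show n + (1 + (n + 0)) = n + 1 + n by ring] at h3

end OddChain

section Decoupling

variable {n₁ n₂ : ℕ} {γ δ : ℝ} {β : ℂ}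
  {H S : Matrix (Idx n₁ n₂ ⊕ Idx n₁ n₂) (Idx n₁ n₂ ⊕ Idx n₁ n₂) ℂ}
  {W₀ : Matrix (Idx n₁ n₂) (Idx n₁ n₂) ℂ} {Y : ℝ → Matrix (Idx n₁ n₂ ⊕ Idx n₁ n₂) (Idx n₁ n₂) ℂ}

lemma blockC_eq_blockD (n₁ n₂ : ℕ) (η : ℝ) (β : ℂ) :
    blockC n₁ n₂ η β = blockD n₁ n₂ η η β := by
  have h1 : (of fun _ _ => Complex.I * η : Matrix Unit Unit ℂ) =
      of fun _ _ => Complex.I / 2 * ((η : ℂ) + η) := by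
    ext; simp; ring
  have h2 : (of fun _ _ => -Complex.I * halfSqrtTwo * ((η : ℂ) - η) : Matrix Unit Unit ℂ) = 0 := by
    ext; simp
  have h3 : (of fun _ _ => -(1 / 2) * ((η : ℂ) - η) : Matrix Unit Unit ℂ) = 0 := by
    ext; simp
  rw [blockC, blockD, h1, h2, h3, fromBlocks_zero, smul_zero]

/-- The linear combination `√2/2 (-x + i σ y)` of the last rows `x`, `y` of the coordinates; the
choices `σ = β` and `σ = -β` decouple the two Jordan chains. -/
def cornerRow (σ : ℂ) (S : Matrix (Idx n₁ n₂ ⊕ Idx n₁ n₂) (Idx n₁ n₂ ⊕ Idx n₁ n₂) ℂ)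
    (Y : ℝ → Matrix (Idx n₁ n₂ ⊕ Idx n₁ n₂) (Idx n₁ n₂) ℂ) (t : ℝ) :
    Matrix (Fin 1) (Idx n₁ n₂) ℂ :=
  of fun _ j => halfSqrtTwo *
    (-coordX S Y t (Sum.inr ()) j + Complex.I * σ * coordY S Y t (Sum.inr ()) j)

lemma IsFlow.isChain_fst (h : IsFlow (blockD n₁ n₂ γ δ β) H S W₀ Y) (hβ : β * β = 1) :
    IsChain (n₁ + 1 + n₁) (Complex.I * γ)
      (oddChain (Complex.I * β) (fun t => (coordX S Y t).toRows₁.toRows₁) (cornerRow β S Y)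
        fun t => (coordY S Y t).toRows₁.toRows₁) := by
  have hs := halfSqrtTwo_mul_self
  refine isChain_oddChain (fun t i j => ?_) (fun t j => ?_) fun t i j => ?_
  · refine (h.hasDerivAt_coordX t (Sum.inl (Sum.inl i)) j).congr_deriv ?_
    simp [Matrix.mul_apply, cornerRow]
    ring
  · have hx := h.hasDerivAt_coordX t (Sum.inr ()) j
    have hy := h.hasDerivAt_coordY t (Sum.inr ()) j
    refine ((hx.neg.add (hy.const_mul (Complex.I * β))).const_mul halfSqrtTwo).congr_deriv ?_
    simp [Matrix.mul_apply, cornerRow]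
    simp only [star_halfSqrtTwo, map_ofNat, mul_assoc, ← Finset.mul_sum]
    generalize ∑ k, (starRingEnd ℂ) (lastE n₁ k ()) * coordY S Y t (Sum.inl (Sum.inl k)) j = A
    generalize ∑ k, (starRingEnd ℂ) (lastE n₂ k ()) * coordY S Y t (Sum.inl (Sum.inr k)) j = B
    linear_combination (2 * Complex.I * β * A + halfSqrtTwo * Complex.I ^ 2 * β * (γ - δ) *
      coordY S Y t (Sum.inr ()) j) * hs - (halfSqrtTwo * Complex.I / 2 * (γ - δ) *
      coordX S Y t (Sum.inr ()) j) * hβ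
  · refine (h.hasDerivAt_coordY t (Sum.inl (Sum.inl i)) j).congr_deriv ?_
    simp [Matrix.mul_apply]

lemma IsFlow.isChain_snd (h : IsFlow (blockD n₁ n₂ γ δ β) H S W₀ Y) (hβ : β * β = 1) :
    IsChain (n₂ + 1 + n₂) (Complex.I * δ)
      (oddChain (Complex.I * -β) (fun t => (coordX S Y t).toRows₁.toRows₂) (cornerRow (-β) S Y)
        fun t => (coordY S Y t).toRows₁.toRows₂) := by
  have hs := halfSqrtTwo_mul_self
  refine isChain_oddChain (fun t i j => ?_) (fun t j => ?_) fun t i j => ?_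
  · refine (h.hasDerivAt_coordX t (Sum.inl (Sum.inr i)) j).congr_deriv ?_
    simp [Matrix.mul_apply, cornerRow]
    ring
  · have hx := h.hasDerivAt_coordX t (Sum.inr ()) j
    have hy := h.hasDerivAt_coordY t (Sum.inr ()) j
    refine ((hx.neg.add (hy.const_mul (Complex.I * -β))).const_mul halfSqrtTwo).congr_deriv ?_
    simp [Matrix.mul_apply, cornerRow]
    simp only [star_halfSqrtTwo, map_ofNat, mul_assoc, ← Finset.mul_sum]
    generalize ∑ k, (starRingEnd ℂ) (lastE n₁ k ()) * coordY S Y t (Sum.inl (Sum.inl k)) j = A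
    generalize ∑ k, (starRingEnd ℂ) (lastE n₂ k ()) * coordY S Y t (Sum.inl (Sum.inr k)) j = B
    linear_combination (-2 * Complex.I * β * B + halfSqrtTwo * Complex.I ^ 2 * β * (γ - δ) *
      coordY S Y t (Sum.inr ()) j) * hs + (halfSqrtTwo * Complex.I / 2 * (γ - δ) *
      coordX S Y t (Sum.inr ()) j) * hβ
  · refine (h.hasDerivAt_coordY t (Sum.inl (Sum.inr i)) j).congr_deriv ?_
    simp [Matrix.mul_apply]

end Decoupling

/-! ### Types `c` and `d`: normal form of the flow -/

lemma MatBigO.fromRows {l : Filter ℝ} {m₁ m₂ n : Type} {A : ℝ → Matrix m₁ n ℂ}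
    {B : ℝ → Matrix m₂ n ℂ} {g : ℝ → ℝ} (hA : MatBigO l A g) (hB : MatBigO l B g) :
    MatBigO l (fun t => Matrix.fromRows (A t) (B t)) g := by
  rintro (i | i) j
  exacts [hA i j, hB i j]

lemma MatBigO.zero {l : Filter ℝ} {m n : Type} {g : ℝ → ℝ} :
    MatBigO l (fun _ => (0 : Matrix m n ℂ)) g :=
  fun _ _ => isBigO_zero _ _

section OddBoundary

variable {c d : Type} {n : ℕ} {a : ℝ} {σ : ℂ}
  {x : ℝ → Matrix (Fin n) c ℂ} {p : ℝ → Matrix (Fin 1) c ℂ} {y : ℝ → Matrix (Fin n) c ℂ}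
  {R : ℝ → Matrix c d ℂ} {T : ℝ → Matrix d d ℂ} {X₀ : Matrix (Fin n) d ℂ}
  {P₀ : Matrix (Fin 1) d ℂ} {Ξ : Matrix (Fin n) d ℂ}

/-- For a chain of odd length with initial values `x(0) = X₀ v` and `p(0) = P₀ v`, the vector
`-(boundaryOp σ X₀ P₀ t) v` is the initial value of `y` for which `x(t) = 0`. -/
def boundaryOp (σ : ℂ) (X₀ : Matrix (Fin n) d ℂ) (P₀ : Matrix (Fin 1) d ℂ) (t : ℝ) :
    Matrix (Fin n) d ℂ :=
  (flipMat n σ)⁻¹ * (botInv n 1 t * divPowMat (topPos n) (topPos n) t) * X₀ +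
    (flipMat n σ)⁻¹ * (botInv n 1 t * divPowMat (topPos n) (midPos n 1) t) * P₀

lemma boundaryOp_bigO : MatBigO pmInfty (boundaryOp σ X₀ P₀) fun t => t⁻¹ :=
  (((botInv_mul_bigO (n := n) (g := 1) (topPos n) fun i => by
      simp only [topPos]; omega).const_mul _).mul_const _).add
    (((botInv_mul_bigO (n := n) (g := 1) (midPos n 1) fun i => by
      simp only [midPos]; omega).const_mul _).mul_const _)

lemma solvesBoundary_oddChain [Fintype c] [Fintype d] (hσ : σ ≠ 0) (hx : ∀ t, x 0 * R t = X₀ * T t)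
    (hp : ∀ t, p 0 * R t = P₀ * T t)
    (hy : ∀ᶠ t in pmInfty, y 0 * R t =
      Complex.exp (-(Complex.I * a * t)) • ((flipMat n σ)⁻¹ * botInv n 1 t * Ξ) -
        boundaryOp σ X₀ P₀ t * T t) :
    SolvesBoundary n 1 a (oddChain σ x p y) R Ξ := by
  have hdF := (Matrix.isUnit_iff_isUnit_det _).1 (isUnit_flipMat n hσ)
  filter_upwards [hy] with t ht
  rw [topRows_oddChain, midRows_oddChain, botRows_oddChain, Matrix.mul_assoc, ht, hx, hp,
    boundaryOp, Matrix.add_mul, Matrix.mul_sub, Matrix.mul_sub, Matrix.mul_sub, Matrix.mul_add,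
    Matrix.mul_smul, Matrix.mul_smul, sub_sub]
  simp only [Matrix.mul_assoc, Matrix.mul_nonsing_inv_cancel_left _ _ hdF]

end OddBoundary

section NormalForm

variable {n₁ n₂ : ℕ} {γ δ : ℝ} {β : ℂ}
  {H S : Matrix (Idx n₁ n₂ ⊕ Idx n₁ n₂) (Idx n₁ n₂ ⊕ Idx n₁ n₂) ℂ}
  {W₀ : Matrix (Idx n₁ n₂) (Idx n₁ n₂) ℂ} {Y : ℝ → Matrix (Idx n₁ n₂ ⊕ Idx n₁ n₂) (Idx n₁ n₂) ℂ}

lemma eLast_mul_conjTranspose (n₁ n₂ : ℕ) :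
    eLast n₁ n₂ * (eLast n₁ n₂)ᴴ = fromBlocks 0 0 0 1 := by
  ext (i | i) (j | j) <;> simp [eLast, Matrix.mul_apply]

lemma cornerRow_inv_corner (h : IsFlow (blockD n₁ n₂ γ δ β) H S W₀ Y)
    (hW : IsUnit (coordW₂ S W₀)) (σ : ℂ) (j : Idx n₁ n₂) :
    (cornerRow σ S Y 0 * (coordW₂ S W₀)⁻¹ * (eLast n₁ n₂ * (eLast n₁ n₂)ᴴ)) 0 j =
      halfSqrtTwo * (-cornerW S W₀ + Complex.I * σ) *
        (eLast n₁ n₂ * (eLast n₁ n₂)ᴴ) (Sum.inr ()) j := by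
  have h1 : ∀ k, (cornerRow σ S Y 0 * (coordW₂ S W₀)⁻¹) 0 k =
      halfSqrtTwo * (-(coordX S Y 0 * (coordW₂ S W₀)⁻¹) (Sum.inr ()) k +
        Complex.I * σ * (coordY S Y 0 * (coordW₂ S W₀)⁻¹) (Sum.inr ()) k) := by
    intro k
    simp only [Matrix.mul_apply, cornerRow, of_apply, Finset.mul_sum, ← Finset.sum_neg_distrib,
      ← Finset.sum_add_distrib]
    exact Finset.sum_congr rfl fun _ _ => by ring
  rw [eLast_mul_conjTranspose, Matrix.mul_apply]
  rcases j with j | j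
  · simp
  · rw [Fintype.sum_sum_type]
    simp only [fromBlocks_apply₁₂, fromBlocks_apply₂₂, Matrix.zero_apply, mul_zero,
      Finset.sum_const_zero, zero_add, Finset.univ_unique, Finset.sum_singleton]
    rw [h1, h.coordX_zero, h.coordY_zero,
      Matrix.mul_nonsing_inv _ ((Matrix.isUnit_iff_isUnit_det _).1 hW)]
    obtain rfl : j = () := rfl
    simp [cornerW]

/-- In canonical coordinates a suitable basis `R` of the solution space tends to the columns
`[1 - e eᴴ + a e eᴴ; b e eᴴ]` with `a = f_u + exp (iθt) g_u` and `b = f_v + exp (iθt) g_v`. It is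
obtained by prescribing the values of `x₁` and `x₂` at the time `t`. -/
lemma flow_normal_form (h : IsFlow (blockD n₁ n₂ γ δ β) H S W₀ Y) (hβ : β * β = 1)
    (hW : IsUnit (coordW₂ S W₀)) {θ : ℝ} (hθ : θ = δ - γ) {w : ℂ} (hw : w = cornerW S W₀) :
    ∃ R : ℝ → Matrix (Idx n₁ n₂) (Idx n₁ n₂) ℂ, (∀ᶠ t in pmInfty, IsUnit (R t)) ∧
      MatBigO pmInfty (fun t => R t - Complex.exp (-(Complex.I * γ * t)) •
        ((coordW₂ S W₀)⁻¹ * (eLast n₁ n₂ * (eLast n₁ n₂)ᴴ))) (fun t => t⁻¹) ∧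
      MatBigO pmInfty (fun t => coordX S Y t * R t - (1 - eLast n₁ n₂ * (eLast n₁ n₂)ᴴ +
        (fu n₁ β w + Complex.exp (Complex.I * θ * t) * gu n₂ β w) •
          (eLast n₁ n₂ * (eLast n₁ n₂)ᴴ))) (fun t => t⁻¹) ∧
      MatBigO pmInfty (fun t => coordY S Y t * R t -
        (fv n₁ β w + Complex.exp (Complex.I * θ * t) * gv n₂ β w) •
          (eLast n₁ n₂ * (eLast n₁ n₂)ᴴ)) (fun t => t⁻¹) := by
  have hβ0 : β ≠ 0 := by rintro rfl; simp at hβ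
  have hdW := (Matrix.isUnit_iff_isUnit_det _).1 hW
  have hσ₁ : Complex.I * β ≠ 0 := mul_ne_zero Complex.I_ne_zero hβ0
  have hσ₂ : Complex.I * -β ≠ 0 := mul_ne_zero Complex.I_ne_zero (neg_ne_zero.2 hβ0)
  set V := (coordW₂ S W₀)⁻¹ with hV
  set e := eLast n₁ n₂ with he
  set X₁ := (coordX S Y 0).toRows₁.toRows₁ * V
  set X₂ := (coordX S Y 0).toRows₁.toRows₂ * V
  set P₁ := cornerRow β S Y 0 * V
  set P₂ := cornerRow (-β) S Y 0 * V
  set Ξ₁ : Matrix (Fin n₁) (Idx n₁ n₂) ℂ := fromCols (fromCols 1 0) 0 with hΞ₁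
  set Ξ₂ : Matrix (Fin n₂) (Idx n₁ n₂) ℂ := fromCols (fromCols 0 1) 0 with hΞ₂
  set B₁ : ℝ → Matrix (Fin n₁) (Fin n₁) ℂ := fun t => Complex.exp (-(Complex.I * γ * t)) •
    ((flipMat n₁ (Complex.I * β))⁻¹ * botInv n₁ 1 t) with hB₁
  set B₂ : ℝ → Matrix (Fin n₂) (Fin n₂) ℂ := fun t => Complex.exp (-(Complex.I * δ * t)) •
    ((flipMat n₂ (Complex.I * -β))⁻¹ * botInv n₂ 1 t) with hB₂
  have hB₁O : MatBigO pmInfty B₁ fun t => t⁻¹ :=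
    MatBigO.bounded_smul (isBigO_cexp_neg_I γ _) (botInv_bigO.const_mul _)
  have hB₂O : MatBigO pmInfty B₂ fun t => t⁻¹ :=
    MatBigO.bounded_smul (isBigO_cexp_neg_I δ _) (botInv_bigO.const_mul _)
  -- With `y(0) R = T`, the conditions `x₁(t) R = Ξ₁`, `x₂(t) R = Ξ₂` together with the prescribed
  -- last row of `T` form the fixed point equation `T = L - K T`; the coupling of the two chains
  -- through `W₁ W₂⁻¹` enters only via `K`.
  set K : ℝ → Matrix (Idx n₁ n₂) (Idx n₁ n₂) ℂ := fun t =>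
    fromRows (fromRows (boundaryOp (Complex.I * β) X₁ P₁ t)
      (boundaryOp (Complex.I * -β) X₂ P₂ t)) 0
  set L : ℝ → Matrix (Idx n₁ n₂) (Idx n₁ n₂) ℂ := fun t =>
    fromBlocks (fromBlocks (B₁ t) 0 0 (B₂ t)) 0 0
      (Complex.exp (-(Complex.I * γ * t)) • 1) with hLdef
  have hK : MatBigO pmInfty K fun t => t⁻¹ :=
    (boundaryOp_bigO.fromRows boundaryOp_bigO).fromRows MatBigO.zero
  have hL₀ : MatBigO pmInfty (fun t => L t - Complex.exp (-(Complex.I * γ * t)) • (e * eᴴ))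
      fun t => t⁻¹ := by
    rw [he, eLast_mul_conjTranspose]
    rintro ((i | i) | i) ((j | j) | j) <;>
      simp only [hLdef, Matrix.sub_apply, Matrix.smul_apply, fromBlocks_apply₁₁, fromBlocks_apply₁₂,
        fromBlocks_apply₂₁, fromBlocks_apply₂₂, Matrix.zero_apply, smul_zero, sub_zero, sub_self]
    · exact hB₁O i j
    · exact isBigO_zero _ _
    · exact isBigO_zero _ _
    · exact isBigO_zero _ _
    · exact hB₂O i j
    · exact isBigO_zero _ _
    · exact isBigO_zero _ _
    · exact isBigO_zero _ _
    · exact isBigO_zero _ _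
  have hE : MatBigO pmInfty (fun t : ℝ => Complex.exp (-(Complex.I * γ * t)) • (e * eᴴ))
      fun _ => (1 : ℝ) := MatBigO.bounded_smul (isBigO_cexp_neg_I γ _) (MatBigO.const _)
  have hL : MatBigO pmInfty L fun _ => (1 : ℝ) := by
    simpa using (hL₀.trans isBigO_inv_pmInfty).add hE
  have hLu : ∀ᶠ t in pmInfty, IsUnit (L t) := by
    filter_upwards [eventually_pmInfty_ne_zero] with t ht
    rw [hLdef, Matrix.isUnit_fromBlocks_zero₂₁, Matrix.isUnit_fromBlocks_zero₂₁]
    refine ⟨⟨?_, ?_⟩, ?_⟩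
    · exact IsUnit.smul (Units.mk0 _ (Complex.exp_ne_zero _))
        (((Matrix.isUnit_nonsing_inv_iff).2 (isUnit_flipMat _ hσ₁)).mul (isUnit_botInv ht))
    · exact IsUnit.smul (Units.mk0 _ (Complex.exp_ne_zero _))
        (((Matrix.isUnit_nonsing_inv_iff).2 (isUnit_flipMat _ hσ₂)).mul (isUnit_botInv ht))
    · exact IsUnit.smul (Units.mk0 _ (Complex.exp_ne_zero _)) isUnit_one
  obtain ⟨T, hfix, hTO, hTu⟩ := fixedPoint_asymptotics hK hL hLu
  have hT₀ : MatBigO pmInfty (fun t => T t - Complex.exp (-(Complex.I * γ * t)) • (e * eᴴ))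
      fun t => t⁻¹ := by
    refine (hL₀.sub (hK.mul_bounded hTO)).congr' ?_
    filter_upwards [hfix] with t ht
    conv_rhs => rw [ht]
    abel
  set R : ℝ → Matrix (Idx n₁ n₂) (Idx n₁ n₂) ℂ := fun t => V * T t with hR
  have hYR : ∀ t, coordY S Y 0 * R t = T t := fun t => by
    rw [h.coordY_zero, hR, hV, Matrix.mul_nonsing_inv_cancel_left _ _ hdW]
  have hb₁ : SolvesBoundary n₁ 1 γ (oddChain (Complex.I * β)
      (fun t => (coordX S Y t).toRows₁.toRows₁) (cornerRow β S Y)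
        fun t => (coordY S Y t).toRows₁.toRows₁) R Ξ₁ := by
    refine solvesBoundary_oddChain (T := T) (X₀ := X₁) (P₀ := P₁) hσ₁
      (fun t => (Matrix.mul_assoc _ _ _).symm) (fun t => (Matrix.mul_assoc _ _ _).symm) ?_
    filter_upwards [hfix] with t ht
    have h1 : (coordY S Y 0).toRows₁.toRows₁ * R t = (T t).toRows₁.toRows₁ :=
      congrArg (fun M : Matrix (Idx n₁ n₂) (Idx n₁ n₂) ℂ => M.toRows₁.toRows₁) (hYR t)
    have h2 : (K t * T t).toRows₁.toRows₁ = boundaryOp (Complex.I * β) X₁ P₁ t * T t := rfl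
    have h3 : (L t).toRows₁.toRows₁ = Complex.exp (-(Complex.I * γ * t)) •
        ((flipMat n₁ (Complex.I * β))⁻¹ * botInv n₁ 1 t * Ξ₁) := by
      rw [hΞ₁, mul_fromCols, mul_fromCols, Matrix.mul_zero, Matrix.mul_zero, Matrix.mul_one]
      ext i ((j | j) | j) <;> simp [hLdef, hB₁]
    rw [h1, ← h2, ← h3]
    conv_lhs => rw [ht]
    rfl
  have hb₂ : SolvesBoundary n₂ 1 δ (oddChain (Complex.I * -β)
      (fun t => (coordX S Y t).toRows₁.toRows₂) (cornerRow (-β) S Y)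
        fun t => (coordY S Y t).toRows₁.toRows₂) R Ξ₂ := by
    refine solvesBoundary_oddChain (T := T) (X₀ := X₂) (P₀ := P₂) hσ₂
      (fun t => (Matrix.mul_assoc _ _ _).symm) (fun t => (Matrix.mul_assoc _ _ _).symm) ?_
    filter_upwards [hfix] with t ht
    have h1 : (coordY S Y 0).toRows₁.toRows₂ * R t = (T t).toRows₁.toRows₂ :=
      congrArg (fun M : Matrix (Idx n₁ n₂) (Idx n₁ n₂) ℂ => M.toRows₁.toRows₂) (hYR t)
    have h2 : (K t * T t).toRows₁.toRows₂ = boundaryOp (Complex.I * -β) X₂ P₂ t * T t := rfl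
    have h3 : (L t).toRows₁.toRows₂ = Complex.exp (-(Complex.I * δ * t)) •
        ((flipMat n₂ (Complex.I * -β))⁻¹ * botInv n₂ 1 t * Ξ₂) := by
      rw [hΞ₂, mul_fromCols, mul_fromCols, Matrix.mul_zero, Matrix.mul_zero, Matrix.mul_one]
      ext i ((j | j) | j) <;> simp [hLdef, hB₂]
    rw [h1, ← h2, ← h3]
    conv_lhs => rw [ht]
    rfl
  have hRO : MatBigO pmInfty R fun _ => (1 : ℝ) := hTO.const_mul _
  have hz₁ := h.isChain_fst hβ
  have hz₂ := h.isChain_snd hβ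
  have htop₁ := hz₁.topRows_boundary hb₁
  have htop₂ := hz₂.topRows_boundary hb₂
  have hbot₁ := hz₁.botRows_boundary hb₁ (hRO.const_mul _) (hRO.const_mul _)
  have hbot₂ := hz₂.botRows_boundary hb₂ (hRO.const_mul _) (hRO.const_mul _)
  have hmid₁ := hz₁.midRows_boundary hb₁ (hRO.const_mul _)
  have hmid₂ := hz₂.midRows_boundary hb₂ (hRO.const_mul _)
  rw [topRows_oddChain] at htop₁ htop₂
  rw [botRows_oddChain] at hbot₁ hbot₂
  rw [midRows_oddChain] at hmid₁ hmid₂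
  -- the lower coordinates of both chains are recovered from their reversals
  have hy₁ : MatBigO pmInfty (fun t => (coordY S Y t).toRows₁.toRows₁ * R t) fun t => t⁻¹ := by
    refine (hbot₁.const_mul (flipMat n₁ (Complex.I * β))⁻¹).congr'
      (Eventually.of_forall fun t => ?_)
    rw [Matrix.mul_assoc, Matrix.nonsing_inv_mul_cancel_left _ _
      ((Matrix.isUnit_iff_isUnit_det _).1 (isUnit_flipMat _ hσ₁))]
  have hy₂ : MatBigO pmInfty (fun t => (coordY S Y t).toRows₁.toRows₂ * R t) fun t => t⁻¹ := by
    refine (hbot₂.const_mul (flipMat n₂ (Complex.I * -β))⁻¹).congr'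
      (Eventually.of_forall fun t => ?_)
    rw [Matrix.mul_assoc, Matrix.nonsing_inv_mul_cancel_left _ _
      ((Matrix.isUnit_iff_isUnit_det _).1 (isUnit_flipMat _ hσ₂))]
  have hcorner : ∀ (σ : ℂ) (a : ℝ) (n : ℕ),
      MatBigO pmInfty (fun t => cornerRow σ S Y t * R t -
        (Complex.exp (Complex.I * a * t) * (-1) ^ n) • (cornerRow σ S Y 0 * R t)) (fun t => t⁻¹) →
      ∀ j, (fun t : ℝ => (cornerRow σ S Y t * R t) 0 j -
        Complex.exp (Complex.I * (a - γ : ℝ) * t) * (-1) ^ n *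
          (halfSqrtTwo * (-w + Complex.I * σ) * (e * eᴴ) (Sum.inr ()) j)) =O[pmInfty]
            fun t => t⁻¹ := by
    intro σ a n hO j
    have h1 : (fun t : ℝ => Complex.exp (Complex.I * a * t) * (-1) ^ n) =O[pmInfty]
        fun _ => (1 : ℝ) := by
      simpa using (isBigO_cexp_I a pmInfty).mul
        (isBigO_const_const ((-1 : ℂ) ^ n) (one_ne_zero (α := ℝ)) pmInfty)
    have h2 := hO.add (MatBigO.bounded_smul h1 (hT₀.const_mul (cornerRow σ S Y 0 * V)))
    refine (h2 0 j).congr_left fun t => ?_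
    have h3 := cornerRow_inv_corner h hW σ j
    rw [← hV, ← he, ← hw] at h3
    have h4 : cornerRow σ S Y 0 * R t = cornerRow σ S Y 0 * V * T t :=
      (Matrix.mul_assoc _ _ _).symm
    beta_reduce
    rw [h4, Matrix.mul_sub, Matrix.mul_smul]
    simp only [Matrix.add_apply, Matrix.sub_apply, Matrix.smul_apply, smul_eq_mul]
    rw [h3, show Complex.I * ((a - γ : ℝ) : ℂ) * t = Complex.I * a * t + -(Complex.I * γ * t) by
      push_cast; ring, Complex.exp_add]
    ring
  have hp₁ := hcorner _ _ _ hmid₁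
  have hp₂ := hcorner _ _ _ hmid₂
  rw [sub_self] at hp₁
  rw [← hθ] at hp₂
  have hs := halfSqrtTwo_mul_self
  have hx₃ : ∀ t j, (coordX S Y t * R t) (Sum.inr ()) j =
      -halfSqrtTwo * ((cornerRow β S Y t * R t) 0 j + (cornerRow (-β) S Y t * R t) 0 j) := by
    intro t j
    simp only [Matrix.mul_apply, cornerRow, of_apply, ← Finset.sum_add_distrib, Finset.mul_sum]
    refine Finset.sum_congr rfl fun k _ => ?_
    linear_combination (-2 * coordX S Y t (Sum.inr ()) k * R t k j) * hs
  have hy₃ : ∀ t j, (coordY S Y t * R t) (Sum.inr ()) j = -(Complex.I * β * halfSqrtTwo) *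
      ((cornerRow β S Y t * R t) 0 j - (cornerRow (-β) S Y t * R t) 0 j) := by
    intro t j
    simp only [Matrix.mul_apply, cornerRow, of_apply, ← Finset.sum_sub_distrib, Finset.mul_sum]
    refine Finset.sum_congr rfl fun k _ => ?_
    linear_combination (2 * β ^ 2 * Complex.I ^ 2 * coordY S Y t (Sum.inr ()) k * R t k j) * hs +
      (β ^ 2 * coordY S Y t (Sum.inr ()) k * R t k j) * Complex.I_sq -
      (coordY S Y t (Sum.inr ()) k * R t k j) * hβ
  refine ⟨R, ?_, ?_, ?_, ?_⟩
  · filter_upwards [hTu] with t ht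
    exact ((Matrix.isUnit_nonsing_inv_iff).2 hW).mul ht
  · refine (hT₀.const_mul V).congr' (Eventually.of_forall fun t => ?_)
    rw [Matrix.mul_sub, Matrix.mul_smul]
  · rintro ((i | i) | i) j
    · refine (isBigO_zero (E' := ℂ) (fun t : ℝ => t⁻¹) pmInfty).congr' ?_ EventuallyEq.rfl
      filter_upwards [htop₁] with t ht
      have h1 : (coordX S Y t * R t) (Sum.inl (Sum.inl i)) j = Ξ₁ i j :=
        congrFun (congrFun ht i) j
      rw [Matrix.sub_apply, h1, he, eLast_mul_conjTranspose]
      rcases j with (j | j) | j <;> simp [hΞ₁, Matrix.one_apply]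
    · refine (isBigO_zero (E' := ℂ) (fun t : ℝ => t⁻¹) pmInfty).congr' ?_ EventuallyEq.rfl
      filter_upwards [htop₂] with t ht
      have h1 : (coordX S Y t * R t) (Sum.inl (Sum.inr i)) j = Ξ₂ i j :=
        congrFun (congrFun ht i) j
      rw [Matrix.sub_apply, h1, he, eLast_mul_conjTranspose]
      rcases j with (j | j) | j <;> simp [hΞ₂, Matrix.one_apply]
    · refine (((hp₁ j).add (hp₂ j)).const_mul_left (-halfSqrtTwo)).congr_left fun t => ?_
      have h1 : (1 - e * eᴴ : Matrix (Idx n₁ n₂) (Idx n₁ n₂) ℂ) (Sum.inr i) j = 0 := by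
        rw [he, eLast_mul_conjTranspose]
        rcases j with j | j <;> simp
      simp only [Matrix.sub_apply, Matrix.add_apply, Matrix.smul_apply, smul_eq_mul] at h1 ⊢
      rw [hx₃, h1, fu, gu]
      simp only [Complex.ofReal_zero, mul_zero, zero_mul, Complex.exp_zero]
      linear_combination (-((-1) ^ n₁ * (w - Complex.I * β)) -
        Complex.exp (Complex.I * θ * t) * (-1) ^ n₂ * (w + Complex.I * β)) *
          (e * eᴴ) (Sum.inr ()) j * hs
  · rintro ((i | i) | i) j
    · refine (hy₁ i j).congr_left fun t => ?_
      beta_reduce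
      rw [Matrix.sub_apply, he, eLast_mul_conjTranspose]
      rcases j with (j | j) | j <;> simp <;> rfl
    · refine (hy₂ i j).congr_left fun t => ?_
      beta_reduce
      rw [Matrix.sub_apply, he, eLast_mul_conjTranspose]
      rcases j with (j | j) | j <;> simp <;> rfl
    · refine (((hp₁ j).sub (hp₂ j)).const_mul_left
        (-(Complex.I * β * halfSqrtTwo))).congr_left fun t => ?_
      simp only [Matrix.sub_apply, Matrix.smul_apply, smul_eq_mul]
      rw [hy₃, fv, gv]
      simp only [Complex.ofReal_zero, mul_zero, zero_mul, Complex.exp_zero]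
      linear_combination (Complex.I * β * ((-1) ^ n₁ * (-w + Complex.I * β) -
        Complex.exp (Complex.I * θ * t) * (-1) ^ n₂ * (-w - Complex.I * β)) *
          (e * eᴴ) (Sum.inr ()) j) * hs + (1 / 2 * ((-1) ^ n₁ +
        Complex.exp (Complex.I * θ * t) * (-1) ^ n₂) * (e * eᴴ) (Sum.inr ()) j) *
          (β ^ 2 * Complex.I_sq - hβ)

end NormalForm

/-! ### Rank-one updates -/

lemma rank_col_mul_row {ι : Type} [Fintype ι] [DecidableEq ι] {u : Matrix ι Unit ℂ}
    {v : Matrix Unit ι ℂ} (hu : u ≠ 0) (hv : v ≠ 0) : (u * v).rank = 1 := by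
  refine le_antisymm ?_ ?_
  · exact (Matrix.rank_mul_le_left u v).trans ((Matrix.rank_le_card_width u).trans (by simp))
  · rw [Nat.one_le_iff_ne_zero, Ne, Matrix.rank, Submodule.finrank_eq_zero,
      LinearMap.range_eq_bot]
    intro h
    obtain ⟨i, hi⟩ : ∃ i, u i () ≠ 0 := by
      by_contra! h0
      exact hu (by ext i j; exact h0 i)
    obtain ⟨k, hk⟩ : ∃ k, v () k ≠ 0 := by
      by_contra! h0
      exact hv (by ext i j; exact h0 j)
    have h1 := congrFun (LinearMap.congr_fun h (Pi.single k 1)) i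
    simp [Matrix.mulVec, dotProduct, hi, hk] at h1

section ShermanMorrison

variable {ι : Type} [Fintype ι] [DecidableEq ι] {A : Matrix ι ι ℂ} {u : Matrix ι Unit ℂ}
  {v : Matrix Unit ι ℂ}

lemma mul_unit_mul {m n : Type} (X : Matrix m Unit ℂ) (s : Matrix Unit Unit ℂ)
    (Z : Matrix Unit n ℂ) : X * (s * Z) = s () () • (X * Z) := by
  ext i j
  simp [Matrix.mul_apply]
  ring

/-- The matrix determinant lemma. -/
lemma isUnit_add_col_mul_row_iff (hA : IsUnit A) (φ : ℂ) :
    IsUnit (A + φ • (u * v)) ↔ 1 + φ * (v * A⁻¹ * u) () () ≠ 0 := by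
  have hA' := (Matrix.isUnit_iff_isUnit_det _).1 hA
  rw [Matrix.isUnit_iff_isUnit_det, ← Matrix.smul_mul, Matrix.det_add_mul _ _ hA',
    Matrix.det_unique (1 + v * A⁻¹ * φ • u), IsUnit.mul_iff, and_iff_right hA', isUnit_iff_ne_zero]
  simp

/-- The Sherman–Morrison formula. -/
lemma inv_add_col_mul_row (hA : IsUnit A) {φ d : ℂ} (hd : d = 1 + φ * (v * A⁻¹ * u) () ())
    (hd0 : d ≠ 0) :
    (A + φ • (u * v))⁻¹ = A⁻¹ - (φ / d) • (A⁻¹ * u * (v * A⁻¹)) := by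
  have hA' := (Matrix.isUnit_iff_isUnit_det _).1 hA
  refine Matrix.inv_eq_right_inv ?_
  have h1 : u * v * (A⁻¹ * u * (v * A⁻¹)) = (v * A⁻¹ * u) () () • (u * (v * A⁻¹)) := by
    rw [← mul_unit_mul]
    simp only [Matrix.mul_assoc]
  have h2 : A * (A⁻¹ * u * (v * A⁻¹)) = u * (v * A⁻¹) := by
    rw [Matrix.mul_assoc, Matrix.mul_nonsing_inv_cancel_left _ _ hA']
  rw [Matrix.add_mul, Matrix.mul_sub, Matrix.mul_sub, Matrix.mul_nonsing_inv _ hA', Matrix.mul_smul,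
    Matrix.mul_smul, Matrix.smul_mul, Matrix.smul_mul, h1, h2, Matrix.mul_assoc, smul_smul,
    smul_smul]
  have h3 : φ / d * φ * (v * A⁻¹ * u) () () = φ - φ / d := by
    field_simp
    rw [hd]
    ring
  rw [h3, sub_smul]
  abel

lemma row_mul_inv_add_col_mul_row (hA : IsUnit A) {φ d : ℂ}
    (hd : d = 1 + φ * (v * A⁻¹ * u) () ()) (hd0 : d ≠ 0) :
    v * (A + φ • (u * v))⁻¹ = d⁻¹ • (v * A⁻¹) := by
  rw [inv_add_col_mul_row hA hd hd0, Matrix.mul_sub, Matrix.mul_smul]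
  have h1 : v * (A⁻¹ * u * (v * A⁻¹)) = (v * A⁻¹ * u) () () • (v * A⁻¹) := by
    have := mul_unit_mul (1 : Matrix Unit Unit ℂ) (v * A⁻¹ * u) (v * A⁻¹)
    rw [Matrix.one_mul, Matrix.one_mul] at this
    rw [← this]
    simp only [Matrix.mul_assoc]
  rw [h1, smul_smul, ← one_smul ℂ (v * A⁻¹), smul_smul, ← sub_smul, smul_smul]
  simp only [one_smul, mul_one]
  congr 1
  field_simp
  rw [hd]
  ring

end ShermanMorrison

/-- Asymptotics of `P Q⁻¹` and `Q⁻¹` when `Q R` and `P R` are, up to `O(t⁻¹)`, bounded oscillating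
rank-one perturbations of constant matrices: the Sherman–Morrison formula isolates the scalar
denominator that decides on the invertibility of `Q`. -/
lemma rankOne_quotient_asymptotics {ι : Type} [Fintype ι] [DecidableEq ι]
    {Q P R : ℝ → Matrix ι ι ℂ} {U₁ U₂ V : Matrix ι ι ℂ} {ζ₁ ζ₂ e : Matrix ι Unit ℂ} {θ γ : ℝ}
    (hQ : MatBigO pmInfty
      (fun t => Q t * R t - (U₁ + Complex.exp (Complex.I * θ * t) • (ζ₁ * eᴴ))) fun t => t⁻¹)
    (hP : MatBigO pmInfty
      (fun t => P t * R t - (U₂ + Complex.exp (Complex.I * θ * t) • (ζ₂ * eᴴ))) fun t => t⁻¹)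
    (hR : MatBigO pmInfty
      (fun t => R t - Complex.exp (-(Complex.I * γ * t)) • (V * (e * eᴴ))) fun t => t⁻¹)
    (hRu : ∀ᶠ t in pmInfty, IsUnit (R t)) (hU : IsUnit U₁) {c : ℂ}
    (hc : c = (eᴴ * U₁⁻¹ * ζ₁) () ()) :
    ∃ (ε : ℝ → ℂ) (E₁ E₂ E₃ E₄ : ℝ → Matrix ι ι ℂ),
      (ε =O[pmInfty] fun t => t⁻¹) ∧
      MatBigO pmInfty E₁ (fun t => t⁻¹) ∧ MatBigO pmInfty E₂ (fun t => t⁻¹) ∧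
      MatBigO pmInfty E₃ (fun t => t⁻¹) ∧ MatBigO pmInfty E₄ (fun t => t⁻¹) ∧
      ∀ᶠ t in pmInfty,
        (IsUnit (Q t) ↔ 1 + Complex.exp (Complex.I * θ * t) * c + ε t ≠ 0) ∧
        (IsUnit (Q t) →
          P t * (Q t)⁻¹ = U₂ * U₁⁻¹
            + (Complex.exp (Complex.I * θ * t)
                / (1 + Complex.exp (Complex.I * θ * t) * c + ε t)) •
                  ((ζ₂ - U₂ * U₁⁻¹ * ζ₁) * eᴴ * U₁⁻¹ + E₁ t)
            + E₂ t ∧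
          (Q t)⁻¹ =
            (Complex.exp (-Complex.I * γ * t)
                / (1 + Complex.exp (Complex.I * θ * t) * c + ε t)) • (V * e * eᴴ * U₁⁻¹ + E₃ t)
            + E₄ t) := by
  set φ : ℝ → ℂ := fun t => Complex.exp (Complex.I * θ * t) with hφ
  set ψ : ℝ → ℂ := fun t => Complex.exp (-(Complex.I * γ * t)) with hψ
  have hφO : φ =O[pmInfty] fun _ => (1 : ℝ) := isBigO_cexp_I θ _
  set A : ℝ → Matrix ι ι ℂ := fun t => Q t * R t - φ t • (ζ₁ * eᴴ) with hAdef
  set A₂ : ℝ → Matrix ι ι ℂ := fun t => P t * R t - φ t • (ζ₂ * eᴴ) with hA₂def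
  set R' : ℝ → Matrix ι ι ℂ := fun t => R t - ψ t • (V * (e * eᴴ)) with hR'def
  have hA : MatBigO pmInfty (fun t => A t - U₁) fun t => t⁻¹ :=
    hQ.congr' (Eventually.of_forall fun t => by simp only [hAdef]; abel)
  have hA₂ : MatBigO pmInfty (fun t => A₂ t - U₂) fun t => t⁻¹ :=
    hP.congr' (Eventually.of_forall fun t => by simp only [hA₂def]; abel)
  obtain ⟨hAu, hAinv⟩ := hA.inv_sub tendsto_inv_pmInfty hU
  have hAb := hAinv.bounded_of_sub isBigO_inv_pmInfty
  have hquot : MatBigO pmInfty (fun t => A₂ t * (A t)⁻¹ - U₂ * U₁⁻¹) fun t => t⁻¹ :=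
    hA₂.mul_sub_mul hAinv isBigO_inv_pmInfty
  have hrow : MatBigO pmInfty (fun t => eᴴ * (A t)⁻¹ - eᴴ * U₁⁻¹) fun t => t⁻¹ :=
    (hAinv.const_mul eᴴ).congr' (Eventually.of_forall fun t => by rw [Matrix.mul_sub])
  have hκ : (fun t => φ t * ((eᴴ * (A t)⁻¹ * ζ₁) () () - c)) =O[pmInfty] fun t => t⁻¹ := by
    have h1 := (hrow.mul_const ζ₁) () ()
    have h2 := hφO.mul h1
    simp only [one_mul] at h2
    refine h2.congr_left fun t => ?_
    rw [hc, Matrix.sub_mul, Matrix.sub_apply]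
  refine ⟨fun t => φ t * ((eᴴ * (A t)⁻¹ * ζ₁) () () - c),
    fun t => (ζ₂ - A₂ t * (A t)⁻¹ * ζ₁) * (eᴴ * (A t)⁻¹) - (ζ₂ - U₂ * U₁⁻¹ * ζ₁) * (eᴴ * U₁⁻¹),
    fun t => A₂ t * (A t)⁻¹ - U₂ * U₁⁻¹,
    fun t => V * e * (eᴴ * (A t)⁻¹ - eᴴ * U₁⁻¹) -
      (φ t * Complex.exp (Complex.I * γ * t)) • (R' t * ((A t)⁻¹ * ζ₁ * (eᴴ * (A t)⁻¹))),
    fun t => R' t * (A t)⁻¹, hκ, ?_, hquot, ?_, hR.mul_bounded hAb, ?_⟩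
  · refine MatBigO.mul_sub_mul (M := fun t => ζ₂ - A₂ t * (A t)⁻¹ * ζ₁) ?_ hrow isBigO_inv_pmInfty
    refine (hquot.mul_const ζ₁).neg.congr' (Eventually.of_forall fun t => ?_)
    rw [Matrix.sub_mul]
    abel
  · refine (hrow.const_mul _).sub (MatBigO.bounded_smul ?_
      (hR.mul_bounded ((hAb.mul_const ζ₁).mul_bounded (hAb.const_mul eᴴ))))
    simpa using hφO.mul (isBigO_cexp_I γ pmInfty)
  · filter_upwards [hAu, hRu] with t hAt hRt
    have hRd := (Matrix.isUnit_iff_isUnit_det _).1 hRt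
    have hAd := (Matrix.isUnit_iff_isUnit_det _).1 hAt
    have hQR : Q t * R t = A t + φ t • (ζ₁ * eᴴ) := by simp only [hAdef]; abel
    have hPR : P t * R t = A₂ t + φ t • (ζ₂ * eᴴ) := by simp only [hA₂def]; abel
    have hden : 1 + φ t * c + φ t * ((eᴴ * (A t)⁻¹ * ζ₁) () () - c) =
        1 + φ t * (eᴴ * (A t)⁻¹ * ζ₁) () () := by ring
    have hiff : IsUnit (Q t) ↔ 1 + φ t * (eᴴ * (A t)⁻¹ * ζ₁) () () ≠ 0 := by
      rw [← isUnit_add_col_mul_row_iff hAt, ← hQR, Matrix.isUnit_iff_isUnit_det,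
        Matrix.isUnit_iff_isUnit_det, Matrix.det_mul, IsUnit.mul_iff,
        and_iff_left hRd]
    have hQinv : (Q t)⁻¹ = R t * (A t + φ t • (ζ₁ * eᴴ))⁻¹ := by
      rw [← hQR, Matrix.mul_inv_rev, ← Matrix.mul_assoc, Matrix.mul_nonsing_inv _ hRd,
        Matrix.one_mul]
    change (IsUnit (Q t) ↔ 1 + φ t * c + φ t * ((eᴴ * (A t)⁻¹ * ζ₁) () () - c) ≠ 0) ∧ _
    rw [hden]
    refine ⟨hiff, fun hQu => ?_⟩
    set d := 1 + φ t * (eᴴ * (A t)⁻¹ * ζ₁) () () with hd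
    have hd0 : d ≠ 0 := hiff.1 hQu
    have hinv := inv_add_col_mul_row hAt hd hd0
    have hrowinv := row_mul_inv_add_col_mul_row hAt hd hd0
    change _ = _ + (φ t / _) • _ + _ ∧ _
    constructor
    · rw [hQinv, ← Matrix.mul_assoc, hPR, Matrix.add_mul, Matrix.smul_mul, Matrix.mul_assoc ζ₂,
        hrowinv, hinv, Matrix.mul_smul, smul_smul, ← div_eq_mul_inv, Matrix.mul_sub,
        Matrix.mul_smul, Matrix.mul_assoc _ eᴴ, add_sub_cancel, Matrix.sub_mul ζ₂, smul_sub]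
      simp only [Matrix.mul_assoc]
      abel
    · rw [show -Complex.I * γ * t = -(Complex.I * γ * t) by ring]
      change _ = (ψ t / _) • _ + _
      have hRR : R t = R' t + ψ t • (V * (e * eᴴ)) := by simp only [hR'def]; abel
      have hψφ : ψ t / d * (φ t * Complex.exp (Complex.I * γ * t)) = φ t / d := by
        have : ψ t * Complex.exp (Complex.I * γ * t) = 1 := by
          rw [hψ, ← Complex.exp_add]; simp
        field_simp
        linear_combination φ t * this
      rw [hQinv, hRR, Matrix.add_mul, Matrix.smul_mul, ← Matrix.mul_assoc V, Matrix.mul_assoc (V * e),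
        hrowinv, hinv, Matrix.mul_smul, smul_smul, ← div_eq_mul_inv, Matrix.mul_sub (R' t),
        Matrix.mul_smul, Matrix.mul_assoc _ eᴴ, smul_add, smul_sub, smul_smul, hψφ, Matrix.mul_sub,
        smul_sub]
      abel

/-! ### Symplectic form and the constants of types `c` and `d` -/

section Symplectic

variable {ι : Type} [Fintype ι] [DecidableEq ι]

lemma fromRows_symJ_fromRows {k : Type} (a b : Matrix ι k ℂ) :
    (fromRows a b)ᴴ * symJ ι * fromRows a b = aᴴ * b - bᴴ * a := by
  rw [conjTranspose_fromRows_eq_fromCols_conjTranspose, symJ, fromCols_mul_fromBlocks,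
    fromCols_mul_fromRows]
  simp only [Matrix.mul_zero, Matrix.mul_one, Matrix.mul_neg, zero_add, add_zero, Matrix.neg_mul]
  abel

lemma IsSymplectic.form_mul {S : Matrix (ι ⊕ ι) (ι ⊕ ι) ℂ} (hS : IsSymplectic S) {k : Type}
    (Z : Matrix (ι ⊕ ι) k ℂ) : (S * Z)ᴴ * symJ ι * (S * Z) = Zᴴ * symJ ι * Z := by
  rw [Matrix.conjTranspose_mul]
  calc Zᴴ * Sᴴ * symJ ι * (S * Z) = Zᴴ * (Sᴴ * symJ ι * S) * Z := by simp only [Matrix.mul_assoc]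
    _ = _ := by rw [hS.conjTranspose_mul]

/-- `W₁ W₂⁻¹` is Hermitian, because the columns of `[I; W₀]` span an isotropic subspace. -/
lemma coord_mul_inv_isHermitian {S : Matrix (ι ⊕ ι) (ι ⊕ ι) ℂ} (hS : IsSymplectic S)
    {W₀ : Matrix ι ι ℂ} (hW₀ : W₀.IsHermitian) (hW : IsUnit (coordW₂ S W₀)) :
    (coordW₁ S W₀ * (coordW₂ S W₀)⁻¹).IsHermitian := by
  have hd := (Matrix.isUnit_iff_isUnit_det _).1 hW
  have h1 : S * fromRows (coordW₁ S W₀) (coordW₂ S W₀) = fromRows 1 W₀ := by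
    obtain ⟨Z, hZ⟩ : ∃ Z : Matrix (ι ⊕ ι) ι ℂ, Z = fromRows 1 W₀ := ⟨_, rfl⟩
    have h0 : fromRows (coordW₁ S W₀) (coordW₂ S W₀) = S⁻¹ * Z := by
      rw [hZ]
      exact fromRows_toRows _
    rw [h0, ← Matrix.mul_assoc, hS.mul_inv, Matrix.one_mul, hZ]
  have h2 := hS.form_mul (fromRows (coordW₁ S W₀) (coordW₂ S W₀))
  rw [h1, fromRows_symJ_fromRows, fromRows_symJ_fromRows, conjTranspose_one, Matrix.one_mul,
    Matrix.mul_one, hW₀.eq, sub_self] at h2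
  set W₁ := coordW₁ S W₀
  set W₂ := coordW₂ S W₀
  have h3 : W₁ᴴ * W₂ = W₂ᴴ * W₁ := sub_eq_zero.1 h2.symm
  have hd' : IsUnit W₂ᴴ.det := by rw [det_conjTranspose]; exact hd.star
  rw [IsHermitian, conjTranspose_mul, conjTranspose_nonsing_inv]
  calc W₂ᴴ⁻¹ * W₁ᴴ = W₂ᴴ⁻¹ * (W₁ᴴ * W₂) * W₂⁻¹ := by
        rw [Matrix.mul_assoc, Matrix.mul_nonsing_inv_cancel_right _ _ hd]
    _ = W₁ * W₂⁻¹ := by rw [h3, Matrix.nonsing_inv_mul_cancel_left _ _ hd']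

end Symplectic

section Constants

variable {n₁ n₂ : ℕ} {β w : ℂ} {S : Matrix (Idx n₁ n₂ ⊕ Idx n₁ n₂) (Idx n₁ n₂ ⊕ Idx n₁ n₂) ℂ}

lemma mixCol_eq (A B : Matrix (Idx n₁ n₂) (Idx n₁ n₂) ℂ) (a b : ℂ) :
    mixCol A B a b = A * (a • eLast n₁ n₂) + B * (b • eLast n₁ n₂) := by
  ext i j
  simp [mixCol, eLast, Matrix.mul_apply, mul_comm]

lemma mixMat_eq (A B : Matrix (Idx n₁ n₂) (Idx n₁ n₂) ℂ) (a b : ℂ) :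
    mixMat A B a b = A * (1 - eLast n₁ n₂ * (eLast n₁ n₂)ᴴ + a • (eLast n₁ n₂ * (eLast n₁ n₂)ᴴ)) +
      B * (b • (eLast n₁ n₂ * (eLast n₁ n₂)ᴴ)) := by
  rw [eLast_mul_conjTranspose]
  ext i (j | j)
  · simp [mixMat, Matrix.mul_apply, Matrix.one_apply, Matrix.add_apply]
  · simp [mixMat, mixCol, Matrix.mul_apply, Matrix.add_apply, mul_comm]

lemma mixMat_add (A B : Matrix (Idx n₁ n₂) (Idx n₁ n₂) ℂ) (a b a' b' : ℂ) :
    mixMat A B (a + a') (b + b') = mixMat A B a b + mixCol A B a' b' * (eLast n₁ n₂)ᴴ := by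
  rw [mixMat_eq, mixMat_eq, mixCol_eq, Matrix.add_mul, Matrix.mul_assoc, Matrix.mul_assoc,
    Matrix.smul_mul, Matrix.smul_mul, add_smul, add_smul, ← add_assoc, Matrix.mul_add A,
    Matrix.mul_add B]
  abel

lemma fv_eq (hβ : β * β = 1) : fv n₁ β w = Complex.I * β * fu n₁ β w := by
  rw [fv, fu]
  linear_combination (1 / 2 * (-1) ^ n₁) * (β ^ 2 * Complex.I_sq - hβ)

lemma gv_eq (hβ : β * β = 1) : gv n₂ β w = -(Complex.I * β * gu n₂ β w) := by
  rw [gv, gu]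
  linear_combination (1 / 2 * (-1) ^ n₂) * (β ^ 2 * Complex.I_sq - hβ)

lemma norm_fu_eq_norm_gu (hβ : star β = β) (hw : star w = w) :
    ‖fu n₁ β w‖ = ‖gu n₂ β w‖ := by
  have h1 : w + Complex.I * β = star (w - Complex.I * β) := by
    rw [star_sub, star_mul', hβ, hw, Complex.star_def, Complex.conj_I]
    ring
  rw [fu, gu, h1, norm_mul, norm_mul, norm_mul, norm_mul, norm_star]
  simp

lemma gu_ne_zero (hβ : star β = β) (hβ0 : β ≠ 0) (hw : star w = w) : gu n₂ β w ≠ 0 := by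
  have h1 : w + Complex.I * β ≠ 0 := by
    intro h
    have h2 := congrArg star h
    rw [star_add, star_mul', hβ, hw, Complex.star_def, Complex.conj_I, map_zero] at h2
    have h3 : Complex.I * β = 0 := by linear_combination (1 / 2 : ℂ) * h - (1 / 2 : ℂ) * h2
    exact mul_ne_zero Complex.I_ne_zero hβ0 h3
  simp [gu, h1]

lemma norm_eq_of_form_eq_zero {G F : ℂ} (h : star (G - F) * (G + F) + star (G + F) * (G - F) = 0) :
    ‖G‖ = ‖F‖ := by
  have h1 : star G * G = star F * F := by
    simp only [star_sub, star_add] at h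
    linear_combination (1 / 2 : ℂ) * h
  have h2 : ∀ z : ℂ, star z * z = ((‖z‖ ^ 2 : ℝ) : ℂ) := fun z => by
    rw [Complex.star_def, mul_comm, Complex.mul_conj, Complex.normSq_eq_norm_sq]
  rw [h2, h2] at h1
  have h3 : ‖G‖ ^ 2 = ‖F‖ ^ 2 := by exact_mod_cast h1
  exact (sq_eq_sq₀ (norm_nonneg _) (norm_nonneg _)).1 h3

/-- The vector `[ζ₁; ζ₂] - [U₁; U₂] U₁⁻¹ ζ₁` has vanishing upper half, hence is isotropic, and it
is nonzero. Expressed in canonical coordinates, isotropy becomes `|g_u| = |f_u c|`, whence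
`|c| = 1`; being nonzero means `ζ₂ ≠ U₂ U₁⁻¹ ζ₁`. -/
lemma norm_corner_eq_one (hS : IsSymplectic S) (hβ : β * β = 1) (hβs : star β = β)
    (hw : star w = w) {U₁ U₂ : Matrix (Idx n₁ n₂) (Idx n₁ n₂) ℂ} {ζ₁ ζ₂ : Matrix (Idx n₁ n₂) Unit ℂ}
    (hU₁ : U₁ = mixMat S.toBlocks₁₁ S.toBlocks₁₂ (fu n₁ β w) (fv n₁ β w))
    (hU₂ : U₂ = mixMat S.toBlocks₂₁ S.toBlocks₂₂ (fu n₁ β w) (fv n₁ β w))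
    (hζ₁ : ζ₁ = mixCol S.toBlocks₁₁ S.toBlocks₁₂ (gu n₂ β w) (gv n₂ β w))
    (hζ₂ : ζ₂ = mixCol S.toBlocks₂₁ S.toBlocks₂₂ (gu n₂ β w) (gv n₂ β w)) (hU : IsUnit U₁) :
    ‖((eLast n₁ n₂)ᴴ * U₁⁻¹ * ζ₁) () ()‖ = 1 ∧ ζ₂ - U₂ * U₁⁻¹ * ζ₁ ≠ 0 := by
  have hβ0 : β ≠ 0 := by rintro rfl; simp at hβ
  have hUd := (Matrix.isUnit_iff_isUnit_det _).1 hU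
  set c := ((eLast n₁ n₂)ᴴ * U₁⁻¹ * ζ₁) () () with hc
  set e := eLast n₁ n₂ with he
  set k := U₁⁻¹ * ζ₁ with hk
  have hek : eᴴ * k = c • 1 := by
    ext i j
    rw [hk, ← Matrix.mul_assoc]
    simp [hc]
  have hee : eᴴ * e = 1 := by
    ext i j
    simp [he, eLast, Matrix.mul_apply]
  -- `[a; b]` are the canonical coordinates of the vector in question, see `hSab`
  set a : Matrix (Idx n₁ n₂) Unit ℂ := (gu n₂ β w + c - fu n₁ β w * c) • e - k with ha
  set b : Matrix (Idx n₁ n₂) Unit ℂ := (gv n₂ β w - fv n₁ β w * c) • e with hb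
  have key : ∀ A B : Matrix (Idx n₁ n₂) (Idx n₁ n₂) ℂ, A * a + B * b =
      mixCol A B (gu n₂ β w) (gv n₂ β w) - mixMat A B (fu n₁ β w) (fv n₁ β w) * k := by
    intro A B
    have h1 : e * eᴴ * k = c • e := by
      rw [Matrix.mul_assoc, hek, Matrix.mul_smul, Matrix.mul_one]
    rw [mixCol_eq, mixMat_eq, ← he, Matrix.add_mul, Matrix.mul_assoc A, Matrix.mul_assoc B,
      Matrix.add_mul, Matrix.sub_mul, Matrix.one_mul, Matrix.smul_mul, Matrix.smul_mul, h1, ha, hb]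
    simp only [Matrix.mul_sub, Matrix.mul_add, Matrix.mul_smul, sub_smul, add_smul, smul_smul]
    abel
  have hSab : S * fromRows a b = fromRows 0 (ζ₂ - U₂ * U₁⁻¹ * ζ₁) := by
    conv_lhs => rw [← fromBlocks_toBlocks S, fromBlocks_mul_fromRows]
    rw [key, key, ← hU₁, ← hU₂, ← hζ₁, ← hζ₂, hk, Matrix.mul_nonsing_inv_cancel_left _ _ hUd,
      sub_self, Matrix.mul_assoc]
  have hea : eᴴ * a = (gu n₂ β w - fu n₁ β w * c) • 1 := by
    rw [ha, Matrix.mul_sub, Matrix.mul_smul, hee, hek, ← sub_smul]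
    congr 1
    ring
  have heb : eᴴ * b = (gv n₂ β w - fv n₁ β w * c) • 1 := by
    rw [hb, Matrix.mul_smul, hee]
  have hvf : gv n₂ β w - fv n₁ β w * c = -(Complex.I * β * (gu n₂ β w + fu n₁ β w * c)) := by
    rw [gv_eq hβ, fv_eq hβ]
    ring
  have hg0 : gu n₂ β w ≠ 0 := gu_ne_zero hβs hβ0 hw
  constructor
  · have hform := hS.form_mul (fromRows a b)
    rw [hSab, fromRows_symJ_fromRows, fromRows_symJ_fromRows, conjTranspose_zero, Matrix.zero_mul,
      Matrix.mul_zero, sub_zero] at hform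
    have hae : aᴴ * e = star (gu n₂ β w - fu n₁ β w * c) • 1 := by
      have := congrArg conjTranspose hea
      rwa [conjTranspose_mul, conjTranspose_conjTranspose, conjTranspose_smul,
        conjTranspose_one] at this
    have hab : aᴴ * b = (star (gu n₂ β w - fu n₁ β w * c) * (gv n₂ β w - fv n₁ β w * c)) • 1 := by
      rw [hb, Matrix.mul_smul, hae, smul_smul, mul_comm]
    have hba : bᴴ * a = (star (gv n₂ β w - fv n₁ β w * c) * (gu n₂ β w - fu n₁ β w * c)) • 1 := by
      rw [hb, conjTranspose_smul, Matrix.smul_mul, hea, smul_smul]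
    rw [hab, hba, ← sub_smul] at hform
    have h0 := congrFun (congrFun hform () ) ()
    simp only [Matrix.zero_apply, Matrix.smul_apply, Matrix.one_apply_eq, smul_eq_mul,
      mul_one] at h0
    rw [hvf] at h0
    have hst : star (-(Complex.I * β * (gu n₂ β w + fu n₁ β w * c))) =
        Complex.I * β * star (gu n₂ β w + fu n₁ β w * c) := by
      rw [star_neg, star_mul', star_mul', hβs, Complex.star_def, Complex.conj_I]
      ring
    rw [hst] at h0
    have h1 : star (gu n₂ β w - fu n₁ β w * c) * (gu n₂ β w + fu n₁ β w * c) +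
        star (gu n₂ β w + fu n₁ β w * c) * (gu n₂ β w - fu n₁ β w * c) = 0 := by
      have h2 : Complex.I * β ≠ 0 := mul_ne_zero Complex.I_ne_zero hβ0
      refine (mul_eq_zero.1 ?_).resolve_left h2
      linear_combination h0
    have h2 := norm_eq_of_form_eq_zero h1
    rw [norm_mul, norm_fu_eq_norm_gu (n₁ := n₁) (n₂ := n₂) hβs hw] at h2
    have h3 : ‖gu n₂ β w‖ ≠ 0 := norm_ne_zero_iff.2 hg0
    field_simp at h2
    exact h2.symm
  · intro h0
    rw [h0, fromRows_zero] at hSab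
    have h1 : fromRows a b = 0 := by
      have := congrArg (S⁻¹ * ·) hSab
      simpa only [← Matrix.mul_assoc, hS.inv_mul, Matrix.one_mul, Matrix.mul_zero] using this
    have ha0 : a = 0 := by
      have := congrArg toRows₁ h1
      rwa [toRows₁_fromRows] at this
    have hb0 : b = 0 := by
      have := congrArg toRows₂ h1
      rwa [toRows₂_fromRows] at this
    rw [ha0, Matrix.mul_zero] at hea
    rw [hb0, Matrix.mul_zero, hvf] at heb
    have h2 := congrFun (congrFun hea ()) ()
    have h3 := congrFun (congrFun heb ()) ()
    simp only [Matrix.zero_apply, Matrix.smul_apply, Matrix.one_apply_eq, smul_eq_mul,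
      mul_one] at h2 h3
    have h4 : gu n₂ β w + fu n₁ β w * c = 0 := by
      refine (mul_eq_zero.1 (neg_eq_zero.1 h3.symm)).resolve_left ?_
      exact mul_ne_zero Complex.I_ne_zero hβ0
    exact hg0 (by linear_combination (1 / 2 : ℂ) * h4 - (1 / 2 : ℂ) * h2)

lemma eLast_ne_zero (n₁ n₂ : ℕ) : eLast n₁ n₂ ≠ 0 := fun h => by
  simpa [eLast] using congrFun (congrFun h (Sum.inr ())) ()

lemma eLast_conjTranspose_mul_ne_zero {M : Matrix (Idx n₁ n₂) (Idx n₁ n₂) ℂ} (hM : IsUnit M) :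
    (eLast n₁ n₂)ᴴ * M⁻¹ ≠ 0 := fun h => by
  have h1 := congrArg (· * M) h
  simp only [Matrix.nonsing_inv_mul_cancel_right _ _ ((Matrix.isUnit_iff_isUnit_det _).1 hM),
    Matrix.zero_mul, conjTranspose_eq_zero] at h1
  exact eLast_ne_zero _ _ h1

lemma mul_eLast_ne_zero {M : Matrix (Idx n₁ n₂) (Idx n₁ n₂) ℂ} (hM : IsUnit M) :
    M⁻¹ * eLast n₁ n₂ ≠ 0 := fun h => by
  have h1 := congrArg (M * ·) h
  simp only [Matrix.mul_nonsing_inv_cancel_left _ _ ((Matrix.isUnit_iff_isUnit_det _).1 hM),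
    Matrix.mul_zero] at h1
  exact eLast_ne_zero _ _ h1

/-- `K_Q` has rank one. -/
lemma rank_inv_mul_eLast_mul {M N : Matrix (Idx n₁ n₂) (Idx n₁ n₂) ℂ} (hM : IsUnit M)
    (hN : IsUnit N) : (M⁻¹ * eLast n₁ n₂ * (eLast n₁ n₂)ᴴ * N⁻¹).rank = 1 := by
  rw [Matrix.mul_assoc]
  exact rank_col_mul_row (mul_eLast_ne_zero hM) (eLast_conjTranspose_mul_ne_zero hN)

end Constants

/-! ### Types `c` and `d` -/

section TypesCD

variable {n₁ n₂ : ℕ} {γ δ : ℝ} {β : ℂ}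
  {H S : Matrix (Idx n₁ n₂ ⊕ Idx n₁ n₂) (Idx n₁ n₂ ⊕ Idx n₁ n₂) ℂ}
  {W₀ : Matrix (Idx n₁ n₂) (Idx n₁ n₂) ℂ} {Y : ℝ → Matrix (Idx n₁ n₂ ⊕ Idx n₁ n₂) (Idx n₁ n₂) ℂ}

/-- Up to `O(t⁻¹)`, a suitable basis `R` of the solution space turns `Q` and `P` into rank-one
perturbations of constant matrices that oscillate with the frequency `θ`. -/
lemma IsFlow.exists_multiplier (h : IsFlow (blockD n₁ n₂ γ δ β) H S W₀ Y) (hβ : β * β = 1)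
    (hW : IsUnit (coordW₂ S W₀)) {θ : ℝ} (hθ : θ = δ - γ) {w : ℂ} (hw : w = cornerW S W₀) :
    ∃ R : ℝ → Matrix (Idx n₁ n₂) (Idx n₁ n₂) ℂ, (∀ᶠ t in pmInfty, IsUnit (R t)) ∧
      MatBigO pmInfty (fun t => R t - Complex.exp (-(Complex.I * γ * t)) •
        ((coordW₂ S W₀)⁻¹ * (eLast n₁ n₂ * (eLast n₁ n₂)ᴴ))) (fun t => t⁻¹) ∧
      MatBigO pmInfty (fun t => flowQ Y t * R t -
        (mixMat S.toBlocks₁₁ S.toBlocks₁₂ (fu n₁ β w) (fv n₁ β w) +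
          Complex.exp (Complex.I * θ * t) • (mixCol S.toBlocks₁₁ S.toBlocks₁₂ (gu n₂ β w)
            (gv n₂ β w) * (eLast n₁ n₂)ᴴ))) (fun t => t⁻¹) ∧
      MatBigO pmInfty (fun t => flowP Y t * R t -
        (mixMat S.toBlocks₂₁ S.toBlocks₂₂ (fu n₁ β w) (fv n₁ β w) +
          Complex.exp (Complex.I * θ * t) • (mixCol S.toBlocks₂₁ S.toBlocks₂₂ (gu n₂ β w)
            (gv n₂ β w) * (eLast n₁ n₂)ᴴ))) (fun t => t⁻¹) := by
  obtain ⟨R, hRu, hR, hX, hY⟩ := flow_normal_form h hβ hW hθ hw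
  have key : ∀ (A B : Matrix (Idx n₁ n₂) (Idx n₁ n₂) ℂ) (F : ℝ → Matrix (Idx n₁ n₂) (Idx n₁ n₂) ℂ),
      (∀ t, F t = A * coordX S Y t + B * coordY S Y t) →
      MatBigO pmInfty (fun t => F t * R t - (mixMat A B (fu n₁ β w) (fv n₁ β w) +
          Complex.exp (Complex.I * θ * t) • (mixCol A B (gu n₂ β w) (gv n₂ β w) *
            (eLast n₁ n₂)ᴴ))) (fun t => t⁻¹) := by
    intro A B F hF
    refine ((hX.const_mul A).add (hY.const_mul B)).congr' (Eventually.of_forall fun t => ?_)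
    have h1 : Complex.exp (Complex.I * θ * t) • (mixCol A B (gu n₂ β w) (gv n₂ β w) *
        (eLast n₁ n₂)ᴴ) = mixCol A B (Complex.exp (Complex.I * θ * t) * gu n₂ β w)
          (Complex.exp (Complex.I * θ * t) * gv n₂ β w) * (eLast n₁ n₂)ᴴ := by
      rw [mixCol, mixCol, ← Matrix.smul_mul, smul_add, smul_smul, smul_smul]
    rw [h1, ← mixMat_add, mixMat_eq, hF, Matrix.add_mul, Matrix.mul_sub A (_ * _),
      Matrix.mul_sub B (_ * _), Matrix.mul_assoc, Matrix.mul_assoc]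
    abel
  exact ⟨R, hRu, hR, key _ _ _ h.flowQ_eq, key _ _ _ h.flowP_eq⟩

lemma riccati_typeC {η : ℝ} (hβ : β = -1 ∨ β = 1)
    (h : IsFlow (blockC n₁ n₂ η β) H S W₀ Y) (hW : IsUnit (coordW₂ S W₀)) {w : ℂ}
    (hw : w = cornerW S W₀) {tu tv : ℂ} (htu : tu = fu n₁ β w + gu n₂ β w)
    (htv : tv = fv n₁ β w + gv n₂ β w) {U₁ U₂ KQ : Matrix (Idx n₁ n₂) (Idx n₁ n₂) ℂ}
    (hU₁ : U₁ = mixMat S.toBlocks₁₁ S.toBlocks₁₂ tu tv)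
    (hU₂ : U₂ = mixMat S.toBlocks₂₁ S.toBlocks₂₂ tu tv)
    (hKQ : KQ = (coordW₂ S W₀)⁻¹ * eLast n₁ n₂ * (eLast n₁ n₂)ᴴ * U₁⁻¹) (hU : IsUnit U₁) :
    KQ.rank = 1 ∧
      (∀ᶠ t in pmInfty, IsUnit (flowQ Y t)) ∧
      MatBigO pmInfty (fun t => flowW Y t - U₂ * U₁⁻¹) (fun t => t⁻¹) ∧
      MatBigO pmInfty
        (fun t => (flowQ Y t)⁻¹ - Complex.exp (-Complex.I * η * t) • KQ) (fun t => t⁻¹) := by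
  have hβ2 : β * β = 1 := by rcases hβ with rfl | rfl <;> norm_num
  rw [blockC_eq_blockD] at h
  obtain ⟨R, hRu, hR, hQ, hP⟩ := h.exists_multiplier hβ2 hW (sub_self η).symm hw
  simp only [Complex.ofReal_zero, mul_zero, zero_mul, Complex.exp_zero, one_smul, ← mixMat_add,
    ← htu, ← htv, ← hU₁, ← hU₂] at hQ hP
  obtain ⟨h1, h2, h3, h4⟩ := quotient_asymptotics tendsto_inv_pmInfty hQ hP hRu hU
  refine ⟨?_, h1, h2, ?_⟩
  · rw [hKQ]
    exact rank_inv_mul_eLast_mul hW hU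
  · have hψ : MatBigO pmInfty (fun t : ℝ => Complex.exp (-(Complex.I * η * t)) •
        ((coordW₂ S W₀)⁻¹ * (eLast n₁ n₂ * (eLast n₁ n₂)ᴴ))) fun _ => (1 : ℝ) :=
      MatBigO.bounded_smul (isBigO_cexp_neg_I η _) (MatBigO.const _)
    refine ((hR.mul_bounded (h4.bounded_of_sub isBigO_inv_pmInfty)).add
      (hψ.bounded_mul h4)).congr' ?_
    filter_upwards [h3] with t ht
    rw [ht, hKQ, show -Complex.I * η * t = -(Complex.I * η * t) by ring, Matrix.sub_mul,
      Matrix.mul_sub, Matrix.smul_mul _ _ U₁⁻¹]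
    simp only [Matrix.mul_assoc]
    abel

lemma riccati_typeD (hβ : β = -1 ∨ β = 1)
    (h : IsFlow (blockD n₁ n₂ γ δ β) H S W₀ Y) (hW : IsUnit (coordW₂ S W₀)) {w : ℂ}
    (hw : w = cornerW S W₀) {U₁ U₂ : Matrix (Idx n₁ n₂) (Idx n₁ n₂) ℂ}
    {ζ₁ ζ₂ : Matrix (Idx n₁ n₂) Unit ℂ}
    (hU₁ : U₁ = mixMat S.toBlocks₁₁ S.toBlocks₁₂ (fu n₁ β w) (fv n₁ β w))
    (hU₂ : U₂ = mixMat S.toBlocks₂₁ S.toBlocks₂₂ (fu n₁ β w) (fv n₁ β w))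
    (hζ₁ : ζ₁ = mixCol S.toBlocks₁₁ S.toBlocks₁₂ (gu n₂ β w) (gv n₂ β w))
    (hζ₂ : ζ₂ = mixCol S.toBlocks₂₁ S.toBlocks₂₂ (gu n₂ β w) (gv n₂ β w))
    {θ : ℝ} (hθ : θ = δ - γ) {c : ℂ} (hc : c = ((eLast n₁ n₂)ᴴ * U₁⁻¹ * ζ₁) () ())
    {KW KQ : Matrix (Idx n₁ n₂) (Idx n₁ n₂) ℂ}
    (hKW : KW = (ζ₂ - U₂ * U₁⁻¹ * ζ₁) * (eLast n₁ n₂)ᴴ * U₁⁻¹)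
    (hKQ : KQ = (coordW₂ S W₀)⁻¹ * eLast n₁ n₂ * (eLast n₁ n₂)ᴴ * U₁⁻¹) (hU : IsUnit U₁) :
    ‖c‖ = 1 ∧ KW.rank = 1 ∧ KQ.rank = 1 ∧
      ∃ (ε : ℝ → ℂ) (E₁ E₂ E₃ E₄ : ℝ → Matrix (Idx n₁ n₂) (Idx n₁ n₂) ℂ),
        (ε =O[pmInfty] fun t => t⁻¹) ∧
        MatBigO pmInfty E₁ (fun t => t⁻¹) ∧ MatBigO pmInfty E₂ (fun t => t⁻¹) ∧
        MatBigO pmInfty E₃ (fun t => t⁻¹) ∧ MatBigO pmInfty E₄ (fun t => t⁻¹) ∧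
        ∀ᶠ t in pmInfty,
          (IsUnit (flowQ Y t) ↔ 1 + Complex.exp (Complex.I * θ * t) * c + ε t ≠ 0) ∧
          (IsUnit (flowQ Y t) →
            flowW Y t = U₂ * U₁⁻¹
              + (Complex.exp (Complex.I * θ * t)
                  / (1 + Complex.exp (Complex.I * θ * t) * c + ε t)) • (KW + E₁ t)
              + E₂ t ∧
            (flowQ Y t)⁻¹ =
              (Complex.exp (-Complex.I * γ * t)
                  / (1 + Complex.exp (Complex.I * θ * t) * c + ε t)) • (KQ + E₃ t)
              + E₄ t) := by
  have hβ2 : β * β = 1 := by rcases hβ with rfl | rfl <;> norm_num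
  have hβs : star β = β := by rcases hβ with rfl | rfl <;> simp
  have hws : star w = w := by
    have := (coord_mul_inv_isHermitian h.symplectic h.hermitian hW).apply (Sum.inr ()) (Sum.inr ())
    rwa [← cornerW, ← hw] at this
  obtain ⟨hc1, hζ⟩ := norm_corner_eq_one h.symplectic hβ2 hβs hws hU₁ hU₂ hζ₁ hζ₂ hU
  obtain ⟨R, hRu, hR, hQ, hP⟩ := h.exists_multiplier hβ2 hW hθ hw
  rw [← hU₁, ← hζ₁] at hQ
  rw [← hU₂, ← hζ₂] at hP
  refine ⟨hc ▸ hc1, ?_, ?_, ?_⟩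
  · rw [hKW, Matrix.mul_assoc]
    exact rank_col_mul_row hζ (eLast_conjTranspose_mul_ne_zero hU)
  · rw [hKQ]
    exact rank_inv_mul_eLast_mul hW hU
  · rw [hKW, hKQ]
    exact rankOne_quotient_asymptotics hQ hP hR hRu hU hc

end TypesCD

end HamRiccati

end

open HamRiccati in
theorem theorem4p9 :
    -- type `r`
    (∀ (n : ℕ) (lam : ℂ), 0 < lam.re →
      ∀ (H S : Matrix (Fin n ⊕ Fin n) (Fin n ⊕ Fin n) ℂ) (W₀ : Matrix (Fin n) (Fin n) ℂ)
        (Y : ℝ → Matrix (Fin n ⊕ Fin n) (Fin n) ℂ),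
      IsFlow (blockR n lam) H S W₀ Y →
      (IsUnit S.toBlocks₁₁ → IsUnit (coordW₁ S W₀) →
        (∀ᶠ t in atTop, IsUnit (flowQ Y t)) ∧
        MatBigO atTop (fun t => flowW Y t - S.toBlocks₂₁ * S.toBlocks₁₁⁻¹)
          (fun t => Real.exp (-2 * lam.re * t) * t ^ (2 * (n - 1))) ∧
        MatBigO atTop (fun t => (flowQ Y t)⁻¹)
          (fun t => Real.exp (-lam.re * t) * t ^ (n - 1))) ∧
      (IsUnit S.toBlocks₁₂ → IsUnit (coordW₂ S W₀) →
        (∀ᶠ t in atBot, IsUnit (flowQ Y t)) ∧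
        MatBigO atBot (fun t => flowW Y t - S.toBlocks₂₂ * S.toBlocks₁₂⁻¹)
          (fun t => Real.exp (-2 * lam.re * |t|) * |t| ^ (2 * (n - 1))) ∧
        MatBigO atBot (fun t => (flowQ Y t)⁻¹)
          (fun t => Real.exp (-lam.re * |t|) * |t| ^ (n - 1)))) ∧
    -- type `e`
    (∀ (n : ℕ) (α : ℝ) (β : ℂ), (β = -1 ∨ β = 1) →
      ∀ (H S : Matrix (Fin n ⊕ Fin n) (Fin n ⊕ Fin n) ℂ) (W₀ : Matrix (Fin n) (Fin n) ℂ)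
        (Y : ℝ → Matrix (Fin n ⊕ Fin n) (Fin n) ℂ),
      IsFlow (blockE n α β) H S W₀ Y →
      IsUnit S.toBlocks₁₁ → IsUnit (coordW₂ S W₀) →
        (∀ᶠ t in pmInfty, IsUnit (flowQ Y t)) ∧
        MatBigO pmInfty (fun t => flowW Y t - S.toBlocks₂₁ * S.toBlocks₁₁⁻¹) (fun t => t⁻¹) ∧
        MatBigO pmInfty (fun t => (flowQ Y t)⁻¹) (fun t => t⁻¹)) ∧
    -- type `c`
    (∀ (n₁ n₂ : ℕ) (η : ℝ) (β : ℂ), (β = -1 ∨ β = 1) →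
      ∀ (H S : Matrix (Idx n₁ n₂ ⊕ Idx n₁ n₂) (Idx n₁ n₂ ⊕ Idx n₁ n₂) ℂ)
        (W₀ : Matrix (Idx n₁ n₂) (Idx n₁ n₂) ℂ)
        (Y : ℝ → Matrix (Idx n₁ n₂ ⊕ Idx n₁ n₂) (Idx n₁ n₂) ℂ),
      IsFlow (blockC n₁ n₂ η β) H S W₀ Y →
      IsUnit (coordW₂ S W₀) →
      ∀ w : ℂ, w = cornerW S W₀ →
      ∀ tu : ℂ, tu = fu n₁ β w + gu n₂ β w →
      ∀ tv : ℂ, tv = fv n₁ β w + gv n₂ β w →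
      ∀ U₁ : Matrix (Idx n₁ n₂) (Idx n₁ n₂) ℂ, U₁ = mixMat S.toBlocks₁₁ S.toBlocks₁₂ tu tv →
      ∀ U₂ : Matrix (Idx n₁ n₂) (Idx n₁ n₂) ℂ, U₂ = mixMat S.toBlocks₂₁ S.toBlocks₂₂ tu tv →
      ∀ KQ : Matrix (Idx n₁ n₂) (Idx n₁ n₂) ℂ,
        KQ = (coordW₂ S W₀)⁻¹ * eLast n₁ n₂ * (eLast n₁ n₂)ᴴ * U₁⁻¹ →
      IsUnit U₁ →
        KQ.rank = 1 ∧
        (∀ᶠ t in pmInfty, IsUnit (flowQ Y t)) ∧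
        MatBigO pmInfty (fun t => flowW Y t - U₂ * U₁⁻¹) (fun t => t⁻¹) ∧
        MatBigO pmInfty
          (fun t => (flowQ Y t)⁻¹ - Complex.exp (-Complex.I * η * t) • KQ) (fun t => t⁻¹)) ∧
    -- type `d`
    (∀ (n₁ n₂ : ℕ) (γ δ : ℝ) (β : ℂ), γ ≠ δ → (β = -1 ∨ β = 1) →
      ∀ (H S : Matrix (Idx n₁ n₂ ⊕ Idx n₁ n₂) (Idx n₁ n₂ ⊕ Idx n₁ n₂) ℂ)
        (W₀ : Matrix (Idx n₁ n₂) (Idx n₁ n₂) ℂ)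
        (Y : ℝ → Matrix (Idx n₁ n₂ ⊕ Idx n₁ n₂) (Idx n₁ n₂) ℂ),
      IsFlow (blockD n₁ n₂ γ δ β) H S W₀ Y →
      IsUnit (coordW₂ S W₀) →
      ∀ w : ℂ, w = cornerW S W₀ →
      ∀ U₁ : Matrix (Idx n₁ n₂) (Idx n₁ n₂) ℂ,
        U₁ = mixMat S.toBlocks₁₁ S.toBlocks₁₂ (fu n₁ β w) (fv n₁ β w) →
      ∀ U₂ : Matrix (Idx n₁ n₂) (Idx n₁ n₂) ℂ,
        U₂ = mixMat S.toBlocks₂₁ S.toBlocks₂₂ (fu n₁ β w) (fv n₁ β w) →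
      ∀ ζ₁ : Matrix (Idx n₁ n₂) Unit ℂ,
        ζ₁ = mixCol S.toBlocks₁₁ S.toBlocks₁₂ (gu n₂ β w) (gv n₂ β w) →
      ∀ ζ₂ : Matrix (Idx n₁ n₂) Unit ℂ,
        ζ₂ = mixCol S.toBlocks₂₁ S.toBlocks₂₂ (gu n₂ β w) (gv n₂ β w) →
      ∀ θ : ℝ, θ = δ - γ →
      ∀ c : ℂ, c = ((eLast n₁ n₂)ᴴ * U₁⁻¹ * ζ₁) () () →
      ∀ KW : Matrix (Idx n₁ n₂) (Idx n₁ n₂) ℂ, KW = (ζ₂ - U₂ * U₁⁻¹ * ζ₁) * (eLast n₁ n₂)ᴴ * U₁⁻¹ →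
      ∀ KQ : Matrix (Idx n₁ n₂) (Idx n₁ n₂) ℂ,
        KQ = (coordW₂ S W₀)⁻¹ * eLast n₁ n₂ * (eLast n₁ n₂)ᴴ * U₁⁻¹ →
      IsUnit U₁ →
        ‖c‖ = 1 ∧ KW.rank = 1 ∧ KQ.rank = 1 ∧
        ∃ (ε : ℝ → ℂ) (E₁ E₂ E₃ E₄ : ℝ → Matrix (Idx n₁ n₂) (Idx n₁ n₂) ℂ),
          (ε =O[pmInfty] fun t => t⁻¹) ∧
          MatBigO pmInfty E₁ (fun t => t⁻¹) ∧ MatBigO pmInfty E₂ (fun t => t⁻¹) ∧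
          MatBigO pmInfty E₃ (fun t => t⁻¹) ∧ MatBigO pmInfty E₄ (fun t => t⁻¹) ∧
          ∀ᶠ t in pmInfty,
            (IsUnit (flowQ Y t) ↔ 1 + Complex.exp (Complex.I * θ * t) * c + ε t ≠ 0) ∧
            (IsUnit (flowQ Y t) →
              flowW Y t = U₂ * U₁⁻¹
                + (Complex.exp (Complex.I * θ * t)
                    / (1 + Complex.exp (Complex.I * θ * t) * c + ε t)) • (KW + E₁ t)
                + E₂ t ∧
              (flowQ Y t)⁻¹ =
                (Complex.exp (-Complex.I * γ * t)
                    / (1 + Complex.exp (Complex.I * θ * t) * c + ε t)) • (KQ + E₃ t)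
                + E₄ t)) := by
  refine ⟨?_, ?_, ?_, ?_⟩
  · intro n lam hlam H S W₀ Y h
    exact riccati_typeR hlam h
  · intro n α β hβ H S W₀ Y h hU hW
    exact riccati_typeE hβ h hU hW
  · intro n₁ n₂ η β hβ H S W₀ Y h hW w hw tu htu tv htv U₁ hU₁ U₂ hU₂ KQ hKQ hU
    exact riccati_typeC hβ h hW hw htu htv hU₁ hU₂ hKQ hU
  · intro n₁ n₂ γ δ β _ hβ H S W₀ Y h hW w hw U₁ hU₁ U₂ hU₂ ζ₁ hζ₁ ζ₂ hζ₂ θ hθ c hc KW hKW KQ hKQ hU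
    exact riccati_typeD hβ h hW hw hU₁ hU₂ hζ₁ hζ₂ hθ hc hKW hKQ hU
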